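/- A *hypergraph* $\mathcal H=(V,\mathcal E)$ consists of a vertex set $V$ and a set $\mathcal E$ of subsets of $V$ (hyperedges). A *support* of $\mathcal H$ is a graph $G$ on $V$ such that $G[F]$ is connected for every $F\in\mathcal E$; it is a *planar support* if $G$ has an embedding in the plane. Two vertices are *twins* if they are contained in exactly the same hyperedges; *twin classes* are the equivalence classes of this relation. For $S\subseteq V$, the hypergraph $\mathcal H-S$ has vertex set $V\setminus S$, and its hyperedges are the sets $F\setminus S$, $F\in\mathcal E$, that have at least two elements; $\mathcal H-t:=\mathcal H-\{t\}$. Let $\ell\ge 1$ be an integer, and let $\mathcal H_\ell$ be the following hypergraph. Its vertices are $v^*$ and, for each $i\in\{1,\dots,\ell\}$, the twelve vertices $a_i,b_i,c_i,d_i,v_{i,a},v_{i,b},v_{i,d},u_{i,b},u_{i,c},u_{i,d},t_i,t_i'$ (all distinct). Its hyperedges of size two are, for each $i$, - the six pairs of vertices of $\{a_i,b_i,c_i,d_i\}$; - $\{a_i,v_{i,a}\},\{v_{i,a},v_{i,d}\},\{v_{i,d},v_{i,b}\},\{v_{i,b},b_i\},\{v_{i,d},d_i\}$; - $\{b_i,u_{i,b}\},\{u_{i,b},u_{i,d}\},\{u_{i,d},u_{i,c}\},\{u_{i,c},c_i\},\{u_{i,d},d_i\}$;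 - $\{a_i,v^*\},\{b_i,v^*\},\{c_i,v^*\}$. Put $A=\{a_i\mid 1\le i\le\ell\}$, $B=\{b_i\mid 1\le i\le\ell\}$, $C=\{c_i\mid 1\le i\le\ell\}$, $V_a=\{v_{i,a}\mid 1\le i\le\ell\}$, $V_b=\{v_{i,b}\mid 1\le i\le\ell\}$, $U_b=\{u_{i,b}\mid 1\le i\le\ell\}$, $U_c=\{u_{i,c}\mid 1\le i\le\ell\}$ and $T=\{t_i,t_i'\mid 1\le i\le\ell\}$. The remaining hyperedges are the eight sets $Y\cup T\cup\{v^*\}$, where $Y$ is one of $$A\cup C\cup V_a,\quad A\cup C\cup V_b,\quad B\cup C\cup V_a,\quad B\cup C\cup V_b,$$ $$B\cup A\cup U_b,\quad B\cup A\cup U_c,\quad C\cup A\cup U_b,\quad C\cup A\cup U_c.$$ Then $\mathcal H_\ell$ is a finite hypergraph all of whose hyperedges have at least two elements, $T$ is a twin class of $\mathcal H_\ell$ with $|T|=2\ell$, and $\mathcal H_\ell$ has a planar support; but for every $t\in T$ the hypergraph $\mathcal H_\ell-t$ has no planar support. More generally, $\mathcal H_\ell-S$ has no planar support for every nonempty $S\subseteq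 T$. Hence arbitrarily many twins can be necessary for a planar support to exist. -/

import Mathlib

namespace HypergraphTwins

/-! ### Planar graphs -/

/-- The Euclidean plane. -/
abbrev Plane : Type := EuclideanSpace ℝ (Fin 2)

/-- `S` is an arc in the plane with endpoints `x` and `y`: it is a homeomorphic image of the closed
unit interval, and the images of `0` and `1` are `x` and `y`. -/
def IsArcBetween (x y : Plane) (S : Set Plane) : Prop :=
  ∃ γ : unitInterval → Plane,
    Topology.IsEmbedding γ ∧ γ 0 = x ∧ γ 1 = y ∧ Set.range γ = S

/-- The points `φ v` and the set `arcs` of arcs form an embedding of the graph `G` into the plane: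
`φ` is injective; every member of `arcs` is an arc with endpoints among the points `φ v`, whose
interior contains no point `φ w` and no point of any other member of `arcs`; and two vertices are
adjacent if and only if their points are linked by a member of `arcs`. -/
structure IsPlaneEmbedding {V : Type*} (G : SimpleGraph V) (φ : V → Plane)
    (arcs : Set (Set Plane)) : Prop where
  injective : Function.Injective φ
  isArc : ∀ S ∈ arcs, ∃ u v : V, IsArcBetween (φ u) (φ v) S ∧
    (∀ w : V, φ w ∉ S \ {φ u, φ v}) ∧
    (∀ S' ∈ arcs, S' ≠ S → Disjoint (S \ {φ u, φ v}) S')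
  adj_iff : ∀ u v : V, G.Adj u v ↔ ∃ S ∈ arcs, IsArcBetween (φ u) (φ v) S

/-- A graph is planar if it has an embedding into the plane. -/
def IsPlanar {V : Type*} (G : SimpleGraph V) : Prop :=
  ∃ (φ : V → Plane) (arcs : Set (Set Plane)), IsPlaneEmbedding G φ arcs

/-! ### Hypergraphs: supports, twins, removal of vertices -/

/-- A support of a hypergraph `H` is a graph on the vertex set of `H` in which every hyperedge
induces a connected subgraph. -/
def IsSupport {α : Type*} (H : Hypergraph α) (G : SimpleGraph H.vertexSet) : Prop :=
  ∀ F ∈ H.edgeSet, (G.induce {v : H.vertexSet | (v : α) ∈ F}).Connected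

/-- `H` has a planar support. -/
def HasPlanarSupport {α : Type*} (H : Hypergraph α) : Prop :=
  ∃ G : SimpleGraph H.vertexSet, IsSupport H G ∧ IsPlanar G

/-- The set of hyperedges that contain `v`. -/
def incidentEdges {α : Type*} (H : Hypergraph α) (v : α) : Set (Set α) :=
  {F | F ∈ H.edgeSet ∧ v ∈ F}

/-- `T` is a twin class of `H`: an equivalence class of the relation "contained in the same
hyperedges" on the vertex set. -/
def IsTwinClass {α : Type*} (H : Hypergraph α) (T : Set α) : Prop :=
  ∃ u ∈ H.vertexSet, T = {v | v ∈ H.vertexSet ∧ incidentEdges H v = incidentEdges H u}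

/-- Removing the vertices in `S`: every hyperedge `F` becomes `F \ S`, and the empty and
singleton sets among these are dropped. -/
def removeVertices {α : Type*} (H : Hypergraph α) (S : Set α) : Hypergraph α where
  vertexSet := H.vertexSet \ S
  edgeSet := {E | (∃ F ∈ H.edgeSet, E = F \ S) ∧ E.Nontrivial}
  subset_vertexSet_of_mem_edgeSet' := by
    rintro E ⟨⟨F, hF, rfl⟩, -⟩
    exact Set.sdiff_subset_sdiff_left (H.subset_vertexSet_of_mem_edgeSet' hF)

/-! ### The construction -/

/-- The twelve vertices of one copy. -/
inductive Label : Type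
  | a | b | c | d | va | vb | vd | ub | uc | ud | t | t'

/-- The vertices of the construction with `ℓ` copies: the distinguished vertex `hub` (written `v*`
informally) and twelve vertices for each copy. -/
inductive Vertex (ℓ : ℕ) : Type
  | hub : Vertex ℓ
  | copy (i : Fin ℓ) (x : Label) : Vertex ℓ

/-- The pairs of vertices that form a size-two hyperedge within each copy. -/
def solidPairs : Set (Label × Label) :=
  {(.a, .b), (.a, .c), (.a, .d), (.b, .c), (.b, .d), (.c, .d),
    (.a, .va), (.va, .vd), (.vd, .vb), (.vb, .b), (.vd, .d),
    (.b, .ub), (.ub, .ud), (.ud, .uc), (.uc, .c), (.ud, .d)}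

/-- The set of all copies of the vertex `x`. -/
def copies (ℓ : ℕ) (x : Label) : Set (Vertex ℓ) :=
  {w | ∃ i : Fin ℓ, w = .copy i x}

/-- The set `T` of all copies of `t` and `t'`. -/
def twinSet (ℓ : ℕ) : Set (Vertex ℓ) :=
  copies ℓ .t ∪ copies ℓ .t'

/-- The triples `(x, y, z)` for which all copies of `x`, `y`, `z` together with `T` and `hub` form
a hyperedge. -/
def largeTriples : Set (Label × Label × Label) :=
  {(.a, .c, .va), (.a, .c, .vb), (.b, .c, .va), (.b, .c, .vb),
    (.b, .a, .ub), (.b, .a, .uc), (.c, .a, .ub), (.c, .a, .uc)}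

/-- The hypergraph with `ℓ` copies. -/
def twinHypergraph (ℓ : ℕ) : Hypergraph (Vertex ℓ) where
  vertexSet := Set.univ
  edgeSet :=
    {F | ∃ (i : Fin ℓ) (x y : Label), (x, y) ∈ solidPairs ∧ F = {.copy i x, .copy i y}} ∪
    {F | ∃ (i : Fin ℓ) (x : Label), (x = .a ∨ x = .b ∨ x = .c) ∧ F = {.copy i x, .hub}} ∪
    {F | ∃ x y z : Label, (x, y, z) ∈ largeTriples ∧
      F = copies ℓ x ∪ copies ℓ y ∪ copies ℓ z ∪ twinSet ℓ ∪ {.hub}}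
  subset_vertexSet_of_mem_edgeSet' := fun _ _ => Set.subset_univ _

end HypergraphTwins

namespace HypergraphTwins

/-! Each copy carries two gadgets on the common K₄ on a, b, c, d, whose corners a, b, c also see the
hub. A gadget is a path p, P, D, Q, q with D joined to d, where (p, q) is (a, b) or (b, c); let r be
the remaining corner among a, b, c. There are 2ℓ gadgets and 2ℓ twins, and in a planar support every
gadget uses up a twin of its own, so no twin can be spared.

Let M and N be the sets reached from P and Q through the surviving twins. Either of them, together
with the path, is a connected set that touches p, q and d. Planarity confines it: an edge to r, to
the hub or to another copy produces a K₃,₃ minor (`IsSupportRel.no_escape`). A large hyperedge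
containing P, r and q must still link P to the hub, and the only way out of M that is left is q;
likewise N sees p (`IsSupportRel.adj_of_large`). If M contained no twin, it would be disjoint from
N, and {D, p, q} against {M, N, d} would be a K₃,₃ minor (`IsSupportRel.exists_common`). A twin
shared by two gadgets would let the first one escape (`IsSupportRel.eq_of_common`). Hence at least
2ℓ twins survive, and nothing was removed.

With all twins present, joining t to a, va, vb, b and t' to b, ub, uc, c gives a support. It is
drawn with straight lines, one copy per cone with apex at the hub.

Embeddings consist of topological arcs. The obstruction is therefore the parity argument of van
Kampen and Hanani–Tutte for K₃,₃, carried out with continuous logarithms of differences of points on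
independent edges (`independent_edges_meet`); it needs no Jordan curve theorem. -/

/-! ### Winding numbers and the graph `K₃,₃` -/

/-- A nowhere vanishing continuous function on a simply connected space has a continuous
logarithm. -/
theorem exists_continuous_log {A : Type*} [TopologicalSpace A] [SimplyConnectedSpace A]
    [LocallyPathConnectedSpace A] {f : A → ℂ} (hf : Continuous f) (h0 : ∀ a, f a ≠ 0) :
    ∃ L : A → ℂ, Continuous L ∧ ∀ a, Complex.exp (L a) = f a := by
  obtain ⟨a₀⟩ : Nonempty A := inferInstance
  obtain ⟨F, ⟨-, hF⟩, -⟩ := Complex.isCoveringMapOn_exp.existsUnique_continuousMap_lifts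
    ⟨f, hf⟩ (a₀ := a₀) (e₀ := Complex.log (f a₀)) (Complex.exp_log (h0 a₀)) h0
  exact ⟨F, F.continuous, fun a => congrFun hF a⟩

/-- The increments of two continuous logarithms of functions that differ by a constant factor
agree. -/
theorem log_increment_eq {A : Type*} [TopologicalSpace A] [SimplyConnectedSpace A]
    [LocallyPathConnectedSpace A] {L M : A → ℂ} {c : ℂ} (hL : Continuous L) (hM : Continuous M)
    (hc : c ≠ 0) (h : ∀ a, Complex.exp (L a) = c * Complex.exp (M a)) (a b : A) :
    L b - L a = M b - M a := by
  have hs : ∀ x, Complex.exp (L x) ∈ ({0}ᶜ : Set ℂ) := fun x => Complex.exp_ne_zero _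
  have hu := Complex.isCoveringMapOn_exp.existsUnique_continuousMap_lifts
    (⟨fun x => Complex.exp (L x), by fun_prop⟩ : C(A, ℂ)) (a₀ := a) (e₀ := L a) rfl hs
  have e := hu.unique (y₁ := ⟨L, hL⟩) (y₂ := ⟨fun x => M x + (L a - M a), by fun_prop⟩)
    ⟨rfl, rfl⟩ ⟨by simp, by
      funext x
      have h1 := h x
      have h2 := h a
      have : Complex.exp (L a) / Complex.exp (M a) = c := by
        rw [h2]; field_simp [Complex.exp_ne_zero]
      simp only [Function.comp, ContinuousMap.coe_mk, Complex.exp_add, Complex.exp_sub, this, h1]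
      ring⟩
  have := congrArg (fun g : C(A, ℂ) => g b) e
  simp only [ContinuousMap.coe_mk] at this
  rw [this]; ring

/-- Add all 18 equations, one for each unordered pair of independent edges of K₃,₃. Every unknown
occurs in exactly two of them, so the left side is even; the right side is 9. -/
theorem parity_contradiction (n m : Fin 3 → Fin 3 → Fin 3 → ℤ)
    (h : ∀ i k j l, i < k → j ≠ l →
      n k i j + m j k l - m l i j - n i k l = if j < l then 1 else 0) : False := by
  have e : ∀ i k, i < k →
      (n k i 0 + m 0 k 1 - m 1 i 0 - n i k 1 = 1 ∧ n k i 0 + m 0 k 2 - m 2 i 0 - n i k 2 = 1 ∧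
      n k i 1 + m 1 k 2 - m 2 i 1 - n i k 2 = 1) ∧
      (n k i 1 + m 1 k 0 - m 0 i 1 - n i k 0 = 0 ∧ n k i 2 + m 2 k 0 - m 0 i 2 - n i k 0 = 0 ∧
      n k i 2 + m 2 k 1 - m 1 i 2 - n i k 1 = 0) := fun i k hik =>
    ⟨⟨by simpa using h i k 0 1 hik (by decide), by simpa using h i k 0 2 hik (by decide),
      by simpa using h i k 1 2 hik (by decide)⟩, by simpa using h i k 1 0 hik (by decide),
      by simpa using h i k 2 0 hik (by decide), by simpa using h i k 2 1 hik (by decide)⟩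
  have e1 := e 0 1 (by decide)
  have e2 := e 0 2 (by decide)
  have e3 := e 1 2 (by decide)
  omega

/-- In every drawing of `K₃,₃` in the plane by continuous curves, two independent edges meet. -/
theorem independent_edges_meet (p q : Fin 3 → ℂ) (γ : Fin 3 → Fin 3 → ℝ → ℂ)
    (hγ : ∀ i j, Continuous (γ i j)) (h0 : ∀ i j, γ i j 0 = p i) (h1 : ∀ i j, γ i j 1 = q j)
    (hd : ∀ i j k l, i ≠ k → j ≠ l → ∀ s t, γ i j s ≠ γ k l t) : False := by
  have other : ∀ i : Fin 3, ∃ k, i ≠ k := by decide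
  have hp : ∀ k i j, k ≠ i → ∀ s, γ i j s - p k ≠ 0 := fun k i j hki s => by
    obtain ⟨l, hl⟩ := other j
    rw [sub_ne_zero, ← h0 k l]
    exact hd i j k l hki.symm hl s 0
  have hq : ∀ l i j, l ≠ j → ∀ s, γ i j s - q l ≠ 0 := fun l i j hlj s => by
    obtain ⟨k, hk⟩ := other i
    rw [sub_ne_zero, ← h1 k l]
    exact hd i j k l hk hlj.symm s 1
  have hpp : ∀ i k, i ≠ k → p k - p i ≠ 0 := fun i k h => by simpa [h0] using hp i k 0 h 0
  have hqq : ∀ i k, i ≠ k → q k - q i ≠ 0 := fun i k h => by simpa [h1] using hq i 0 k h 1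
  have hpq : ∀ i j, q j - p i ≠ 0 := fun i j => by
    obtain ⟨k, hk⟩ := other i
    simpa [h1] using hp i k j hk 1
  choose α hαc hα using fun (k i j : Fin 3) (h : k ≠ i) =>
    exists_continuous_log (f := fun s => γ i j s - p k) (by have := hγ i j; fun_prop) (hp k i j h)
  choose β hβc hβ using fun (l i j : Fin 3) (h : l ≠ j) =>
    exists_continuous_log (f := fun s => γ i j s - q l) (by have := hγ i j; fun_prop) (hq l i j h)
  -- the four sides of the square belonging to a pair of independent edges
  have square : ∀ i j k l (hik : i ≠ k) (hjl : j ≠ l),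
      (α k i j hik.symm 1 - α k i j hik.symm 0) + (β j k l hjl 1 - β j k l hjl 0) =
      (β l i j hjl.symm 1 - β l i j hjl.symm 0) + (α i k l hik 1 - α i k l hik 0) := by
    intro i j k l hik hjl
    obtain ⟨L, hLc, hL⟩ := exists_continuous_log
      (f := fun z : ℝ × ℝ => γ i j z.1 - γ k l z.2)
      (by have := hγ i j; have := hγ k l; fun_prop)
      (fun z => sub_ne_zero.2 (hd i j k l hik hjl _ _))
    have e1 := log_increment_eq (L := fun s => L (s, 0)) (M := α k i j hik.symm) (c := 1)
      (by fun_prop) (hαc _ _ _ _) one_ne_zero (fun s => by simp [hL, hα, h0]) 0 1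
    have e2 := log_increment_eq (L := fun s => L (s, 1)) (M := β l i j hjl.symm) (c := 1)
      (by fun_prop) (hβc _ _ _ _) one_ne_zero (fun s => by simp [hL, hβ, h1]) 0 1
    have e3 := log_increment_eq (L := fun s => L (0, s)) (M := α i k l hik) (c := -1)
      (by fun_prop) (hαc _ _ _ _) (by simp) (fun s => by simp [hL, hα, h0]) 0 1
    have e4 := log_increment_eq (L := fun s => L (1, s)) (M := β j k l hjl) (c := -1)
      (by fun_prop) (hβc _ _ _ _) (by simp) (fun s => by simp [hL, hβ, h1]) 0 1
    rw [← e1, ← e2, ← e3, ← e4]; ring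
  -- Reference logarithms of the differences of vertices on the same side. The values for the two
  -- orders of a pair differ by exactly πi, and the order of the indices decides which is larger;
  -- this asymmetry makes the parity count odd.
  let A : Fin 3 → Fin 3 → ℂ := fun k i =>
    if k < i then Complex.log (p i - p k) else Complex.log (p k - p i) + Real.pi * Complex.I
  let D : Fin 3 → Fin 3 → ℂ := fun k i =>
    if k < i then Complex.log (q i - q k) else Complex.log (q k - q i) + Real.pi * Complex.I
  have hA : ∀ k i, k ≠ i → Complex.exp (A k i) = p i - p k := fun k i h => by
    by_cases hlt : k < i
    · simp [A, hlt, Complex.exp_log (hpp k i h)]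
    · simp [A, hlt, Complex.exp_add, Complex.exp_log (hpp i k h.symm)]
  have hD : ∀ k i, k ≠ i → Complex.exp (D k i) = q i - q k := fun k i h => by
    by_cases hlt : k < i
    · simp [D, hlt, Complex.exp_log (hqq k i h)]
    · simp [D, hlt, Complex.exp_add, Complex.exp_log (hqq i k h.symm)]
  have hn : ∀ k i j, ∃ n : ℤ, ∀ h : k ≠ i, α k i j h 1 - α k i j h 0 =
      Complex.log (q j - p k) - A k i + n * (2 * Real.pi * Complex.I) := fun k i j => by
    by_cases h : k = i
    · exact ⟨0, fun h' => absurd h h'⟩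
    · obtain ⟨n, hn⟩ := Complex.exp_eq_exp_iff_exists_int.1
        (show Complex.exp (α k i j h 1 - α k i j h 0) =
          Complex.exp (Complex.log (q j - p k) - A k i) by
          rw [Complex.exp_sub, Complex.exp_sub, hα, hα, h0, h1, hA k i h,
            Complex.exp_log (hpq k j)])
      exact ⟨n, fun _ => hn⟩
  -- The curve starts at p i - q l, the negative of the difference used in `hn`, hence the shift by
  -- πi. With this choice the mixed logarithms cancel in the square relation.
  have hm : ∀ l i j, ∃ m : ℤ, ∀ h : l ≠ j, β l i j h 1 - β l i j h 0 =
      D l j - (Complex.log (q l - p i) + Real.pi * Complex.I) + m * (2 * Real.pi * Complex.I) :=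
    fun l i j => by
    by_cases h : l = j
    · exact ⟨0, fun h' => absurd h h'⟩
    · obtain ⟨n, hn⟩ := Complex.exp_eq_exp_iff_exists_int.1
        (show Complex.exp (β l i j h 1 - β l i j h 0) =
          Complex.exp (D l j - (Complex.log (q l - p i) + Real.pi * Complex.I)) by
          rw [Complex.exp_sub, Complex.exp_sub, hβ, hβ, h0, h1, hD l j h, Complex.exp_add,
            Complex.exp_log (hpq i l), Complex.exp_pi_mul_I, mul_neg_one, neg_sub])
      exact ⟨n, fun _ => hn⟩
  choose n hn using hn
  choose m hm using hm
  have hpi : (2 * Real.pi * Complex.I : ℂ) ≠ 0 := Complex.two_pi_I_ne_zero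
  refine parity_contradiction n m fun i k j l hik hjl => ?_
  have hs := square i j k l hik.ne hjl
  rw [hn, hn, hm, hm] at hs
  have hAA : A k i = A i k + Real.pi * Complex.I := by simp [A, hik, hik.not_gt]
  have key : ((n k i j + m j k l - m l i j - n i k l : ℤ) : ℂ) * (2 * Real.pi * Complex.I) =
      ((if j < l then 1 else 0 : ℤ) : ℂ) * (2 * Real.pi * Complex.I) := by
    push_cast
    rcases hjl.lt_or_gt with h | h
    · have hDD : D l j = D j l + Real.pi * Complex.I := by simp [D, h, h.not_gt]
      rw [hAA, hDD] at hs
      simp only [h, if_true]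
      linear_combination hs
    · have hDD : D j l = D l j + Real.pi * Complex.I := by simp [D, h, h.not_gt]
      rw [hAA, hDD] at hs
      simp only [h.not_gt, if_false]
      linear_combination hs
  exact_mod_cast mul_right_cancel₀ hpi key

/-! ### Plane embeddings and `K₃,₃` minors -/

/-- Any two points of `W` are linked by a chain for the relation `E` inside `W`. -/
def IsLinked {α : Type*} (E : α → α → Prop) (W : Set α) : Prop :=
  ∀ x ∈ W, ∀ y ∈ W, Relation.ReflTransGen (fun u v => E u v ∧ u ∈ W ∧ v ∈ W) x y

/-- The part of the plane covered by the vertices in `W` and the arcs between them. -/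
def drawnRegion {V : Type*} (φ : V → Plane) (arcs : Set (Set Plane)) (W : Set V) : Set Plane :=
  φ '' W ∪ {x | ∃ u ∈ W, ∃ v ∈ W, ∃ S ∈ arcs, IsArcBetween (φ u) (φ v) S ∧ x ∈ S}

theorem IsArcBetween.left_mem {x y : Plane} {S : Set Plane} (h : IsArcBetween x y S) : x ∈ S := by
  obtain ⟨γ, -, h0, -, rfl⟩ := h
  exact ⟨0, h0⟩

theorem IsArcBetween.right_mem {x y : Plane} {S : Set Plane} (h : IsArcBetween x y S) : y ∈ S := by
  obtain ⟨γ, -, -, h1, rfl⟩ := h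
  exact ⟨1, h1⟩

theorem IsArcBetween.ne {x y : Plane} {S : Set Plane} (h : IsArcBetween x y S) : x ≠ y := by
  obtain ⟨γ, hγ, rfl, rfl, -⟩ := h
  exact fun e => zero_ne_one (hγ.injective e)

theorem IsArcBetween.joinedIn {x y : Plane} {S : Set Plane} (h : IsArcBetween x y S) :
    JoinedIn S x y := by
  obtain ⟨γ, hγ, h0, h1, rfl⟩ := h
  exact ⟨⟨⟨γ, hγ.continuous⟩, h0, h1⟩, fun t => ⟨t, rfl⟩⟩

section planeEmbedding

variable {V : Type*} {G : SimpleGraph V} {φ : V → Plane} {arcs : Set (Set Plane)}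

theorem joinedIn_drawnRegion (h : IsPlaneEmbedding G φ arcs) {W : Set V} {x y : V} (hx : x ∈ W)
    (hxy : Relation.ReflTransGen (fun u v => G.Adj u v ∧ u ∈ W ∧ v ∈ W) x y) :
    JoinedIn (drawnRegion φ arcs W) (φ x) (φ y) := by
  induction hxy with
  | refl => exact JoinedIn.refl (Or.inl ⟨x, hx, rfl⟩)
  | tail _ hE ih =>
    obtain ⟨hadj, hu, hv⟩ := hE
    obtain ⟨S, hS, hA⟩ := (h.adj_iff _ _).1 hadj
    exact ih.trans (hA.joinedIn.mono fun z hz => Or.inr ⟨_, hu, _, hv, S, hS, hA, hz⟩)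

/-- A vertex on an arc is one of its endpoints. -/
theorem IsPlaneEmbedding.eq_or_eq (h : IsPlaneEmbedding G φ arcs) {S : Set Plane} (hS : S ∈ arcs)
    {u v w : V} (hA : IsArcBetween (φ u) (φ v) S) (hw : φ w ∈ S) : w = u ∨ w = v := by
  obtain ⟨a, b, -, hab, -⟩ := h.isArc S hS
  have hmem : ∀ x, φ x ∈ S → x = a ∨ x = b := fun x hx => by
    by_contra hne
    push Not at hne
    exact hab x ⟨hx, by simp [h.injective.eq_iff, hne.1, hne.2]⟩
  have huv : u ≠ v := fun e => hA.ne (congrArg φ e)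
  rcases hmem u hA.left_mem with rfl | rfl <;> rcases hmem v hA.right_mem with rfl | rfl <;>
    rcases hmem w hw with rfl | rfl <;> simp_all

/-- Two arcs meet only in common endpoints. -/
theorem IsPlaneEmbedding.eq_or_eq_of_mem (h : IsPlaneEmbedding G φ arcs) {S S' : Set Plane}
    (hS : S ∈ arcs) (hS' : S' ∈ arcs) (hne : S' ≠ S) {u v : V} (hA : IsArcBetween (φ u) (φ v) S)
    {z : Plane} (hz : z ∈ S) (hz' : z ∈ S') : z = φ u ∨ z = φ v := by
  obtain ⟨a, b, hab, -, hd⟩ := h.isArc S hS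
  have huv : u ≠ v := fun e => hA.ne (congrArg φ e)
  have hz2 : z = φ a ∨ z = φ b := by
    by_contra hn
    exact Set.disjoint_left.1 (hd S' hS' hne) ⟨hz, by simpa using hn⟩ hz'
  rcases h.eq_or_eq hS hA hab.left_mem with rfl | rfl <;>
    rcases h.eq_or_eq hS hA hab.right_mem with rfl | rfl
  exacts [absurd rfl hab.ne, hz2, hz2.symm, absurd rfl hab.ne]

/-- Arcs meet only in common endpoints, and both endpoints of an arc counted in a region belong to
its vertex set, so a common point would be a common vertex. -/
theorem disjoint_drawnRegion (h : IsPlaneEmbedding G φ arcs) {W W' : Set V}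
    (hW : Disjoint W W') : Disjoint (drawnRegion φ arcs W) (drawnRegion φ arcs W') := by
  have hne : ∀ {x y}, x ∈ W → y ∈ W' → x ≠ y := fun hx hy e =>
    Set.disjoint_left.1 hW hx (e ▸ hy)
  rw [Set.disjoint_left]
  rintro z (⟨u, hu, rfl⟩ | ⟨u, hu, v, hv, S, hS, hA, hz⟩)
    (⟨u', hu', he⟩ | ⟨u', hu', v', hv', S', hS', hA', hz'⟩)
  · exact hne hu hu' (h.injective he).symm
  · rcases h.eq_or_eq hS' hA' hz' with e | e
    · exact hne hu hu' e
    · exact hne hu hv' e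
  · subst he
    rcases h.eq_or_eq hS hA hz with e | e
    · exact hne hu hu' e.symm
    · exact hne hv hu' e.symm
  · by_cases hSS : S' = S
    · subst hSS
      rcases h.eq_or_eq hS hA hA'.left_mem with e | e
      · exact hne hu hu' e.symm
      · exact hne hv hu' e.symm
    · rcases h.eq_or_eq_of_mem hS hS' hSS hA hz hz' with rfl | rfl
      · rcases h.eq_or_eq hS' hA' hz' with e | e
        · exact hne hu hu' e
        · exact hne hu hv' e
      · rcases h.eq_or_eq hS' hA' hz' with e | e
        · exact hne hv hu' e
        · exact hne hv hv' e

/-- The plane as the complex numbers. -/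
def planeToComplex (x : Plane) : ℂ := ⟨x 0, x 1⟩

theorem continuous_planeToComplex : Continuous planeToComplex := by
  have : planeToComplex = fun x : Plane => (x 0 : ℂ) + (x 1 : ℂ) * Complex.I := by
    funext x
    apply Complex.ext <;> simp [planeToComplex]
  rw [this]
  fun_prop

theorem planeToComplex_injective : Function.Injective planeToComplex := fun x y h => by
  have h0 := congrArg Complex.re h
  have h1 := congrArg Complex.im h
  ext i
  fin_cases i
  · exact h0
  · exact h1

theorem IsLinked.union {α : Type*} {E : α → α → Prop} (hE : ∀ u v, E u v → E v u) {W W' : Set α}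
    (hW : IsLinked E W) (hW' : IsLinked E W') (h : ∃ x ∈ W, ∃ y ∈ W', E x y) :
    IsLinked E (W ∪ W') := by
  obtain ⟨x₀, hx₀, y₀, hy₀, hxy⟩ := h
  have l : ∀ x ∈ W, ∀ y ∈ W,
      Relation.ReflTransGen (fun u v => E u v ∧ u ∈ W ∪ W' ∧ v ∈ W ∪ W') x y := fun x hx y hy =>
    Relation.ReflTransGen.mono (fun u v huv => ⟨huv.1, Or.inl huv.2.1, Or.inl huv.2.2⟩)
      _ _ (hW x hx y hy)
  have r : ∀ x ∈ W', ∀ y ∈ W',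
      Relation.ReflTransGen (fun u v => E u v ∧ u ∈ W ∪ W' ∧ v ∈ W ∪ W') x y := fun x hx y hy =>
    Relation.ReflTransGen.mono (fun u v huv => ⟨huv.1, Or.inr huv.2.1, Or.inr huv.2.2⟩)
      _ _ (hW' x hx y hy)
  rintro x (hx | hx) y (hy | hy)
  · exact l x hx y hy
  · exact ((l x hx x₀ hx₀).tail ⟨hxy, Or.inl hx₀, Or.inr hy₀⟩).trans (r y₀ hy₀ y hy)
  · exact ((r x hx y₀ hy₀).tail ⟨hE _ _ hxy, Or.inr hy₀, Or.inl hx₀⟩).trans (l x₀ hx₀ y hy)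
  · exact r x hx y hy

theorem isLinked_singleton {α : Type*} (E : α → α → Prop) (x : α) : IsLinked E {x} := by
  rintro _ rfl _ rfl
  exact .refl

/-- A planar graph has no `K₃,₃` minor. -/
theorem IsPlanar.no_bipartite_minor (hG : IsPlanar G) (P Q : Fin 3 → Set V)
    (hP : ∀ i, IsLinked G.Adj (P i)) (hQ : ∀ j, IsLinked G.Adj (Q j))
    (hPP : ∀ i k, i ≠ k → Disjoint (P i) (P k)) (hQQ : ∀ i k, i ≠ k → Disjoint (Q i) (Q k))
    (hPQ : ∀ i j, Disjoint (P i) (Q j)) (hadj : ∀ i j, ∃ x ∈ P i, ∃ y ∈ Q j, G.Adj x y) :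
    False := by
  obtain ⟨φ, arcs, h⟩ := hG
  choose a ha b hb hab using hadj
  -- Fix one representative vertex in each branch set. The curves so obtained may overlap when they
  -- share an end; only curves for independent edges have to be disjoint.
  have hJ : ∀ i j, JoinedIn (drawnRegion φ arcs (P i ∪ Q j)) (φ (a i 0)) (φ (b 0 j)) := by
    intro i j
    have hl := (hP i).union (fun _ _ e => e.symm) (hQ j) ⟨_, ha i j, _, hb i j, hab i j⟩
    exact joinedIn_drawnRegion h (Or.inl (ha i 0)) (hl _ (Or.inl (ha i 0)) _ (Or.inr (hb 0 j)))
  choose γ hγ using hJ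
  refine independent_edges_meet (fun i => planeToComplex (φ (a i 0)))
    (fun j => planeToComplex (φ (b 0 j))) (fun i j s => planeToComplex ((γ i j).extend s))
    (fun i j => continuous_planeToComplex.comp (γ i j).continuous_extend)
    (fun i j => by simp) (fun i j => by simp) fun i j k l hik hjl s t e => ?_
  have hdis := disjoint_drawnRegion (W := P i ∪ Q j) (W' := P k ∪ Q l) h (by
    rw [Set.disjoint_union_left, Set.disjoint_union_right, Set.disjoint_union_right]
    exact ⟨⟨hPP i k hik, hPQ i l⟩, (hPQ k j).symm, hQQ j l hjl⟩)
  have hs : ∀ i j s, (γ i j).extend s ∈ drawnRegion φ arcs (P i ∪ Q j) := fun i j s => hγ i j _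
  exact Set.disjoint_left.1 hdis (hs i j s) (planeToComplex_injective e ▸ hs k l t)

end planeEmbedding

/-- The adjacency relation of a graph on a subtype, as a relation on the ambient type. -/
def ambientAdj {α : Type*} {s : Set α} (G : SimpleGraph s) (x y : α) : Prop :=
  ∃ (hx : x ∈ s) (hy : y ∈ s), G.Adj ⟨x, hx⟩ ⟨y, hy⟩

theorem ambientAdj.symm {α : Type*} {s : Set α} {G : SimpleGraph s} (x y : α)
    (h : ambientAdj G x y) : ambientAdj G y x := by
  obtain ⟨hx, hy, h⟩ := h
  exact ⟨hy, hx, h.symm⟩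

theorem IsLinked.preimage {α : Type*} {s : Set α} {G : SimpleGraph s} {W : Set α}
    (h : IsLinked (ambientAdj G) W) : IsLinked G.Adj (Subtype.val ⁻¹' W : Set s) := by
  rintro ⟨x, hxs⟩ hx ⟨y, hys⟩ hy
  have key : ∀ y, Relation.ReflTransGen (fun u v => ambientAdj G u v ∧ u ∈ W ∧ v ∈ W) x y →
      ∃ hys : y ∈ s, Relation.ReflTransGen (fun u v : s => G.Adj u v ∧
        u ∈ (Subtype.val ⁻¹' W : Set s) ∧ v ∈ (Subtype.val ⁻¹' W : Set s)) ⟨x, hxs⟩ ⟨y, hys⟩ := by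
    intro y hxy
    induction hxy with
    | refl => exact ⟨hxs, .refl⟩
    | tail _ hE ih =>
      obtain ⟨⟨_, hv, hadj⟩, huW, hvW⟩ := hE
      obtain ⟨_, ih⟩ := ih
      exact ⟨hv, ih.tail ⟨hadj, huW, hvW⟩⟩
  exact (key y (h x hx y hy)).2

/-- A planar graph on a subtype has no `K₃,₃` minor, stated in the ambient type. -/
theorem IsPlanar.no_ambient_bipartite_minor {α : Type*} {s : Set α} {G : SimpleGraph s}
    (hG : IsPlanar G) {P₁ P₂ P₃ Q₁ Q₂ Q₃ : Set α}
    (hP₁ : IsLinked (ambientAdj G) P₁) (hP₂ : IsLinked (ambientAdj G) P₂)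
    (hP₃ : IsLinked (ambientAdj G) P₃) (hQ₁ : IsLinked (ambientAdj G) Q₁)
    (hQ₂ : IsLinked (ambientAdj G) Q₂) (hQ₃ : IsLinked (ambientAdj G) Q₃)
    (hd : [P₁, P₂, P₃, Q₁, Q₂, Q₃].Pairwise Disjoint)
    (hadj : ∀ P ∈ [P₁, P₂, P₃], ∀ Q ∈ [Q₁, Q₂, Q₃], ∃ x ∈ P, ∃ y ∈ Q, ambientAdj G x y) :
    False := by
  simp only [List.pairwise_cons, List.mem_cons, List.not_mem_nil, or_false, forall_eq_or_imp,
    forall_eq, IsEmpty.forall_iff, implies_true, and_true, List.Pairwise.nil] at hd hadj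
  have pre : ∀ {A B : Set α}, Disjoint A B →
      Disjoint (Subtype.val ⁻¹' A : Set s) (Subtype.val ⁻¹' B) := fun h => h.preimage _
  have adj : ∀ {A B : Set α}, (∃ x ∈ A, ∃ y ∈ B, ambientAdj G x y) →
      ∃ x ∈ (Subtype.val ⁻¹' A : Set s), ∃ y ∈ (Subtype.val ⁻¹' B : Set s), G.Adj x y := by
    rintro A B ⟨x, hx, y, hy, hxs, hys, h⟩
    exact ⟨⟨x, hxs⟩, hx, ⟨y, hys⟩, hy, h⟩
  refine hG.no_bipartite_minor ![Subtype.val ⁻¹' P₁, Subtype.val ⁻¹' P₂, Subtype.val ⁻¹' P₃]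
    ![Subtype.val ⁻¹' Q₁, Subtype.val ⁻¹' Q₂, Subtype.val ⁻¹' Q₃] ?_ ?_ ?_ ?_ ?_ ?_
  · simp [Fin.forall_fin_succ, hP₁.preimage, hP₂.preimage, hP₃.preimage]
  · simp [Fin.forall_fin_succ, hQ₁.preimage, hQ₂.preimage, hQ₃.preimage]
  · have h12 := pre hd.1.1
    have h13 := pre hd.1.2.1
    have h23 := pre hd.2.1.1
    simp [Fin.forall_fin_succ, h12, h13, h23, h12.symm, h13.symm, h23.symm]
  · have h12 := pre hd.2.2.2.1.1
    have h13 := pre hd.2.2.2.1.2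
    have h23 := pre hd.2.2.2.2
    simp [Fin.forall_fin_succ, h12, h13, h23, h12.symm, h13.symm, h23.symm]
  · simp only [Fin.forall_fin_succ]
    simp [pre hd.1.2.2.1, pre hd.1.2.2.2.1, pre hd.1.2.2.2.2, pre hd.2.1.2.1, pre hd.2.1.2.2.1,
      pre hd.2.1.2.2.2, pre hd.2.2.1.1, pre hd.2.2.1.2.1, pre hd.2.2.1.2.2]
  · obtain ⟨⟨h1, h2, h3⟩, ⟨h4, h5, h6⟩, h7, h8, h9⟩ := hadj
    intro i j
    fin_cases i <;> fin_cases j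
    exacts [adj h1, adj h2, adj h3, adj h4, adj h5, adj h6, adj h7, adj h8, adj h9]

/-! ### Linked sets -/

theorem isLinked_of_root {α : Type*} {E : α → α → Prop} (hE : ∀ u v, E u v → E v u) {W : Set α}
    (r : α) (h : ∀ x ∈ W, Relation.ReflTransGen (fun u v => E u v ∧ u ∈ W ∧ v ∈ W) x r) :
    IsLinked E W := fun x hx y hy => (h x hx).trans <| by
  have : ∀ a b, (fun u v => E u v ∧ u ∈ W ∧ v ∈ W) a b →
      (fun u v => E u v ∧ u ∈ W ∧ v ∈ W) b a := fun a b hab => ⟨hE _ _ hab.1, hab.2.2, hab.2.1⟩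
  have : Std.Symm (fun u v => E u v ∧ u ∈ W ∧ v ∈ W) := ⟨this⟩
  exact Relation.ReflTransGen.stdSymm.symm _ _ (h y hy)

/-- A linked set that meets `M` but is not contained in `M` has an edge leaving `M`. -/
theorem IsLinked.exists_exit {α : Type*} {E : α → α → Prop} {W M : Set α} (h : IsLinked E W)
    {x y : α} (hx : x ∈ W) (hy : y ∈ W) (hxM : x ∈ M) (hyM : y ∉ M) :
    ∃ z ∈ M, ∃ w ∈ W, w ∉ M ∧ E z w := by
  have hxy := h x hx y hy
  induction hxy with
  | refl => exact absurd hxM hyM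
  | @tail b c _ hE ih =>
    by_cases hb : b ∈ M
    · exact ⟨b, hb, c, hE.2.2, hyM, hE.1⟩
    · exact ih hE.2.1 hb

theorem IsLinked.adj_of_pair {α : Type*} {E : α → α → Prop} {u v : α} (hE : ∀ x, ¬ E x x)
    (huv : u ≠ v) (h : IsLinked E {u, v}) : E u v := by
  obtain ⟨z, rfl, w, rfl | rfl, hw, hzw⟩ :=
    h.exists_exit (M := {u}) (Or.inl rfl) (Or.inr rfl) rfl (fun e => huv e.symm)
  · exact absurd hzw (hE _)
  · exact hzw

/-- The vertices that can be reached from `x` through vertices in `U`, including `x`. -/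
def reachThrough {α : Type*} (E : α → α → Prop) (U : Set α) (x : α) : Set α :=
  {y | Relation.ReflTransGen (fun u v => E u v ∧ v ∈ U) x y}

section reachThrough

variable {α : Type*} {E : α → α → Prop} {U : Set α}

theorem mem_reachThrough_self (x : α) : x ∈ reachThrough E U x := Relation.ReflTransGen.refl

theorem eq_or_mem_of_mem_reachThrough {x y : α} (h : y ∈ reachThrough E U x) : y = x ∨ y ∈ U := by
  rcases Relation.ReflTransGen.cases_tail h with rfl | ⟨_, _, _, hy⟩
  · exact Or.inl rfl
  · exact Or.inr hy

theorem isLinked_reachThrough (hE : ∀ u v, E u v → E v u) (x : α) :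
    IsLinked E (reachThrough E U x) := by
  refine isLinked_of_root hE x fun y hy => ?_
  induction hy with
  | refl => exact .refl
  | tail hb hbc ih => exact .head ⟨hE _ _ hbc.1, hb.tail hbc, hb⟩ ih

/-- Maximality of the reached set: every edge leaving it ends outside `U`. -/
theorem notMem_of_notMem_reachThrough {x y z : α} (hz : z ∈ reachThrough E U x)
    (hy : y ∉ reachThrough E U x) (hzy : E z y) : y ∉ U :=
  fun hU => hy (Relation.ReflTransGen.tail hz ⟨hzy, hU⟩)

/-- If `t ∈ U` is reached from `x` and from `w ∉ U`, then `w` has a neighbour that is reached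
from `x`. -/
theorem exists_adj_of_mem_reachThrough (hE : ∀ u v, E u v → E v u) {x w t : α} (ht : t ∈ U)
    (hw : w ∉ U) (hx : t ∈ reachThrough E U x) (hwt : t ∈ reachThrough E U w) :
    ∃ z ∈ reachThrough E U x, E z w := by
  have key : ∀ s, Relation.ReflTransGen (fun u v => E u v ∧ v ∈ U) s t →
      (s ∈ U → s ∈ reachThrough E U x) ∧ (s ∉ U → ∃ z ∈ reachThrough E U x, E z s) := by
    intro s hs
    induction hs using Relation.ReflTransGen.head_induction_on with
    | refl => exact ⟨fun _ => hx, fun h => absurd ht h⟩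
    | head hab _ ih =>
      have hb := ih.1 hab.2
      exact ⟨fun ha => Relation.ReflTransGen.tail hb ⟨hE _ _ hab.1, ha⟩,
        fun _ => ⟨_, hb, hE _ _ hab.1⟩⟩
  exact (key w hwt).2 hw

end reachThrough

/-! ### The two gadgets of a copy -/

/-- The first end of the path with the inner vertices `va, vd, vb` (for `true`) or `ub, ud, uc`
(for `false`). -/
def endP : Bool → Label | true => .a | false => .b
/-- The last end of the path. -/
def endQ : Bool → Label | true => .b | false => .c
/-- The vertex among `a`, `b`, `c` that is not an end of the path. -/
def third : Bool → Label | true => .c | false => .a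
/-- The first inner vertex of the path. -/
def innerP : Bool → Label | true => .va | false => .ub
/-- The middle vertex of the path. -/
def innerD : Bool → Label | true => .vd | false => .ud
/-- The last inner vertex of the path. -/
def innerQ : Bool → Label | true => .vb | false => .uc

/-- The labels of the inner vertices of the two paths of a copy. -/
def IsInner (x : Label) : Prop := ∃ σ, x = innerP σ ∨ x = innerD σ ∨ x = innerQ σ

/-- The hub and all vertices outside `T` of the copies other than the `i`-th one. -/
def restSet (ℓ : ℕ) (i : Fin ℓ) : Set (Vertex ℓ) :=
  {w | w = .hub ∨ ∃ j x, j ≠ i ∧ x ≠ .t ∧ x ≠ .t' ∧ w = .copy j x}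

theorem mem_twinSet {ℓ : ℕ} {w : Vertex ℓ} :
    w ∈ twinSet ℓ ↔ ∃ i, w = .copy i .t ∨ w = .copy i .t' := by
  simp [twinSet, copies, exists_or]

theorem hub_notMem_twinSet (ℓ : ℕ) : Vertex.hub ∉ twinSet ℓ := by simp [mem_twinSet]

theorem copy_mem_twinSet {ℓ : ℕ} {i : Fin ℓ} {x : Label} :
    Vertex.copy i x ∈ twinSet ℓ ↔ x = .t ∨ x = .t' := by
  simp [mem_twinSet, exists_or]

/-- The hyperedge belonging to a triple of labels. -/
def largeEdge (ℓ : ℕ) (x y z : Label) : Set (Vertex ℓ) :=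
  copies ℓ x ∪ copies ℓ y ∪ copies ℓ z ∪ twinSet ℓ ∪ {.hub}

theorem mem_largeEdge {ℓ : ℕ} {x y z : Label} {w : Vertex ℓ} : w ∈ largeEdge ℓ x y z ↔
    (∃ i, w = .copy i x) ∨ (∃ i, w = .copy i y) ∨ (∃ i, w = .copy i z) ∨ w ∈ twinSet ℓ ∨
      w = .hub := by
  simp only [largeEdge, copies, Set.mem_union, Set.mem_ofPred_eq, Set.mem_singleton_iff, or_assoc]

/-- The properties of the adjacency relation of a support of the hypergraph without `S`. -/
structure IsSupportRel (ℓ : ℕ) (S : Set (Vertex ℓ)) (E : Vertex ℓ → Vertex ℓ → Prop) : Prop where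
  symm : ∀ u v, E u v → E v u
  solid : ∀ i x y, (x, y) ∈ solidPairs → E (.copy i x) (.copy i y)
  hub : ∀ i x, (x = .a ∨ x = .b ∨ x = .c) → E (.copy i x) .hub
  large : ∀ x y z, (x, y, z) ∈ largeTriples → IsLinked E (largeEdge ℓ x y z \ S)

section support

variable {ℓ : ℕ} {S : Set (Vertex ℓ)} {E : Vertex ℓ → Vertex ℓ → Prop}

theorem IsSupportRel.solid' (h : IsSupportRel ℓ S E) (i : Fin ℓ) (x y : Label)
    (hxy : (x, y) ∈ solidPairs ∨ (y, x) ∈ solidPairs) : E (.copy i x) (.copy i y) :=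
  hxy.elim (h.solid i x y) fun hyx => h.symm _ _ (h.solid i y x hyx)

/-- Makes everything outside the copy available as one branch set. The twins are left out because
they may already belong to the branch set of a gadget. -/
theorem IsSupportRel.isLinked_restSet (h : IsSupportRel ℓ S E) (i : Fin ℓ) :
    IsLinked E (restSet ℓ i) := by
  have hub : Vertex.hub ∈ restSet ℓ i := Or.inl rfl
  refine isLinked_of_root h.symm .hub ?_
  rintro _ (rfl | ⟨j, x, hj, ht, ht', rfl⟩)
  · exact .refl
  have mem : ∀ y, y ≠ .t → y ≠ .t' → Vertex.copy j y ∈ restSet ℓ i := fun y h1 h2 =>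
    Or.inr ⟨j, y, hj, h1, h2, rfl⟩
  have top : ∀ y, (y = .a ∨ y = .b ∨ y = .c) → Relation.ReflTransGen
      (fun u v => E u v ∧ u ∈ restSet ℓ i ∧ v ∈ restSet ℓ i) (.copy j y) .hub := fun y hy =>
    .single ⟨h.hub j y hy, mem y (by rintro rfl; simp at hy) (by rintro rfl; simp at hy), hub⟩
  have step : ∀ y z, y ≠ .t → y ≠ .t' → z ≠ .t → z ≠ .t' →
      ((y, z) ∈ solidPairs ∨ (z, y) ∈ solidPairs) → Relation.ReflTransGen
      (fun u v => E u v ∧ u ∈ restSet ℓ i ∧ v ∈ restSet ℓ i) (.copy j y) (.copy j z) :=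
    fun y z h1 h2 h3 h4 hyz => .single ⟨h.solid' j y z hyz, mem y h1 h2, mem z h3 h4⟩
  have hd := (step .d .a (by simp) (by simp) (by simp) (by simp) (by simp [solidPairs])).trans
    (top .a (by simp))
  cases x
  case a => exact top _ (by simp)
  case b => exact top _ (by simp)
  case c => exact top _ (by simp)
  case d => exact hd
  case va => exact (step .va .a (by simp) (by simp) (by simp) (by simp)
    (by simp [solidPairs])).trans (top .a (by simp))
  case vb => exact (step .vb .b (by simp) (by simp) (by simp) (by simp)
    (by simp [solidPairs])).trans (top .b (by simp))
  case vd => exact (step .vd .d (by simp) (by simp) (by simp) (by simp)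
    (by simp [solidPairs])).trans hd
  case ub => exact (step .ub .b (by simp) (by simp) (by simp) (by simp)
    (by simp [solidPairs])).trans (top .b (by simp))
  case uc => exact (step .uc .c (by simp) (by simp) (by simp) (by simp)
    (by simp [solidPairs])).trans (top .c (by simp))
  case ud => exact (step .ud .d (by simp) (by simp) (by simp) (by simp)
    (by simp [solidPairs])).trans hd
  case t => exact absurd rfl ht
  case t' => exact absurd rfl ht'

/-- The edges of a gadget. -/
theorem IsSupportRel.gadget (h : IsSupportRel ℓ S E) (i : Fin ℓ) (σ : Bool) :
    (E (.copy i (endP σ)) (.copy i (endQ σ)) ∧ E (.copy i (endP σ)) (.copy i .d) ∧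
      E (.copy i (endQ σ)) (.copy i .d) ∧ E (.copy i (third σ)) (.copy i .d) ∧
      E (.copy i (third σ)) (.copy i (endP σ)) ∧ E (.copy i (third σ)) (.copy i (endQ σ))) ∧
    (E (.copy i (innerP σ)) (.copy i (endP σ)) ∧ E (.copy i (innerQ σ)) (.copy i (endQ σ)) ∧
      E (.copy i (innerD σ)) (.copy i .d) ∧ E (.copy i (innerP σ)) (.copy i (innerD σ)) ∧
      E (.copy i (innerQ σ)) (.copy i (innerD σ))) ∧
    (E (.copy i (endP σ)) .hub ∧ E (.copy i (endQ σ)) .hub ∧ E (.copy i (third σ)) .hub) := by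
  cases σ <;>
  exact ⟨⟨h.solid' _ _ _ (by simp [solidPairs, endP, endQ]),
      h.solid' _ _ _ (by simp [solidPairs, endP]), h.solid' _ _ _ (by simp [solidPairs, endQ]),
      h.solid' _ _ _ (by simp [solidPairs, third]),
      h.solid' _ _ _ (by simp [solidPairs, endP, third]),
      h.solid' _ _ _ (by simp [solidPairs, endQ, third])⟩,
    ⟨h.solid' _ _ _ (by simp [solidPairs, endP, innerP]),
      h.solid' _ _ _ (by simp [solidPairs, endQ, innerQ]),
      h.solid' _ _ _ (by simp [solidPairs, innerD]),
      h.solid' _ _ _ (by simp [solidPairs, innerD, innerP]),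
      h.solid' _ _ _ (by simp [solidPairs, innerD, innerQ])⟩,
    h.hub _ _ (by simp [endP]), h.hub _ _ (by simp [endQ]), h.hub _ _ (by simp [third])⟩

theorem disjoint_restSet_of_inner {i : Fin ℓ} {W : Set (Vertex ℓ)}
    (hW : ∀ w ∈ W, w ∈ twinSet ℓ ∨ ∃ x, IsInner x ∧ w = .copy i x) :
    Disjoint W (restSet ℓ i) := by
  rw [Set.disjoint_left]
  rintro w hw (rfl | ⟨j, x, hj, h1, h2, rfl⟩)
  · rcases hW _ hw with h | ⟨x, -, h⟩
    · exact hub_notMem_twinSet ℓ h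
    · cases h
  · rcases hW _ hw with h | ⟨x, -, h⟩
    · exact (copy_mem_twinSet.1 h).elim h1 h2
    · cases h
      exact hj rfl

theorem disjoint_singleton_of_inner {i : Fin ℓ} {W : Set (Vertex ℓ)} {y : Label}
    (hW : ∀ w ∈ W, w ∈ twinSet ℓ ∨ ∃ x, IsInner x ∧ w = .copy i x)
    (hy : y = .a ∨ y = .b ∨ y = .c ∨ y = .d) : Disjoint W {Vertex.copy i y} := by
  rw [Set.disjoint_singleton_right]
  intro hw
  rcases hW _ hw with h | ⟨x, ⟨σ, hx⟩, h⟩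
  · rcases copy_mem_twinSet.1 h with rfl | rfl <;> simp at hy
  · cases h
    cases σ <;> rcases hy with rfl | rfl | rfl | rfl <;> simp [innerP, innerD, innerQ] at hx

theorem disjoint_singleton_restSet (i : Fin ℓ) (y : Label) :
    Disjoint {Vertex.copy i y} (restSet ℓ i) := by
  rw [Set.disjoint_singleton_left]
  rintro (h | ⟨j, x, hj, -, -, h⟩)
  · cases h
  · cases h
    exact hj rfl

theorem disjoint_copy (i : Fin ℓ) {x y : Label} (h : x ≠ y) :
    Disjoint ({Vertex.copy i x} : Set (Vertex ℓ)) {Vertex.copy i y} := by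
  simpa using h

/-! ### Forbidden minors around a gadget -/

variable {s : Set (Vertex ℓ)} {G : SimpleGraph s}

/-- A linked set containing the path of a gadget has no edge to the rest of the graph. -/
theorem IsSupportRel.no_escape (h : IsSupportRel ℓ S (ambientAdj G)) (hG : IsPlanar G)
    {i : Fin ℓ} {σ : Bool} {W : Set (Vertex ℓ)} (hl : IsLinked (ambientAdj G) W)
    (hW : ∀ w ∈ W, w ∈ twinSet ℓ ∨ ∃ x, IsInner x ∧ w = .copy i x)
    (hP : .copy i (innerP σ) ∈ W) (hD : .copy i (innerD σ) ∈ W) (hQ : .copy i (innerQ σ) ∈ W)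
    {z y : Vertex ℓ} (hz : z ∈ W) (hzy : ambientAdj G z y)
    (hy : y ∈ restSet ℓ i ∨ y = .copy i (third σ)) : False := by
  obtain ⟨⟨hpq, hpd, hqd, hrd, hrp, hrq⟩, ⟨hPp, hQq, hDd, -, -⟩, hph, hqh, hrh⟩ := h.gadget i σ
  have hub : Vertex.hub ∈ restSet ℓ i := Or.inl rfl
  have hp : endP σ = .a ∨ endP σ = .b ∨ endP σ = .c ∨ endP σ = .d := by cases σ <;> simp [endP]
  have hq : endQ σ = .a ∨ endQ σ = .b ∨ endQ σ = .c ∨ endQ σ = .d := by cases σ <;> simp [endQ]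
  have hr : third σ = .a ∨ third σ = .b ∨ third σ = .c ∨ third σ = .d := by
    cases σ <;> simp [third]
  have npq : endP σ ≠ endQ σ := by cases σ <;> simp [endP, endQ]
  have npr : endP σ ≠ third σ := by cases σ <;> simp [endP, third]
  have nqr : endQ σ ≠ third σ := by cases σ <;> simp [third, endQ]
  have npd : endP σ ≠ .d := by cases σ <;> simp [endP]
  have nqd : endQ σ ≠ .d := by cases σ <;> simp [endQ]
  have nrd : third σ ≠ .d := by cases σ <;> simp [third]
  have dp := disjoint_singleton_of_inner hW hp
  have dq := disjoint_singleton_of_inner hW hq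
  have dr := disjoint_singleton_of_inner hW hr
  have dd := disjoint_singleton_of_inner (y := .d) hW (by simp)
  have dR := disjoint_restSet_of_inner hW
  have sing := isLinked_singleton (ambientAdj G)
  have hR := h.isLinked_restSet i
  have sR := disjoint_singleton_restSet (ℓ := ℓ) i
  rcases hy with hy | rfl
  -- Branch sets {W, r, p} against {q, d, rest}; the assumed edge supplies the pair W, rest, and the
  -- hub serves r and p.
  · refine hG.no_ambient_bipartite_minor hl (sing (.copy i (third σ))) (sing (.copy i (endP σ)))
      (sing (.copy i (endQ σ))) (sing (.copy i .d)) hR ?_ ?_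
    · simp only [List.pairwise_cons, List.mem_cons, List.not_mem_nil, or_false, forall_eq_or_imp,
        forall_eq, IsEmpty.forall_iff, implies_true, and_true, List.Pairwise.nil]
      exact ⟨⟨dr, dp, dq, dd, dR⟩, ⟨disjoint_copy i npr.symm, disjoint_copy i nqr.symm,
        disjoint_copy i nrd, sR _⟩, ⟨disjoint_copy i npq, disjoint_copy i npd, sR _⟩,
        ⟨disjoint_copy i nqd, sR _⟩, sR _⟩
    · simp only [List.mem_cons, List.not_mem_nil, or_false, forall_eq_or_imp, forall_eq]
      exact ⟨⟨⟨_, hQ, _, rfl, hQq⟩, ⟨_, hD, _, rfl, hDd⟩, _, hz, _, hy, hzy⟩,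
        ⟨⟨_, rfl, _, rfl, hrq⟩, ⟨_, rfl, _, rfl, hrd⟩, _, rfl, _, hub, hrh⟩,
        ⟨_, rfl, _, rfl, hpq⟩, ⟨_, rfl, _, rfl, hpd⟩, _, rfl, _, hub, hph⟩
  -- Branch sets {W, rest, d} against {p, q, r}; the assumed edge supplies the pair W, r.
  · refine hG.no_ambient_bipartite_minor hl hR (sing (.copy i .d)) (sing (.copy i (endP σ)))
      (sing (.copy i (endQ σ))) (sing (.copy i (third σ))) ?_ ?_
    · simp only [List.pairwise_cons, List.mem_cons, List.not_mem_nil, or_false, forall_eq_or_imp,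
        forall_eq, IsEmpty.forall_iff, implies_true, and_true, List.Pairwise.nil]
      exact ⟨⟨dR, dd, dp, dq, dr⟩, ⟨(sR _).symm, (sR _).symm, (sR _).symm, (sR _).symm⟩,
        ⟨disjoint_copy i npd.symm, disjoint_copy i nqd.symm, disjoint_copy i nrd.symm⟩,
        ⟨disjoint_copy i npq, disjoint_copy i npr⟩, disjoint_copy i nqr⟩
    · simp only [List.mem_cons, List.not_mem_nil, or_false, forall_eq_or_imp, forall_eq]
      exact ⟨⟨⟨_, hP, _, rfl, hPp⟩, ⟨_, hQ, _, rfl, hQq⟩, _, hz, _, rfl, hzy⟩,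
        ⟨⟨_, hub, _, rfl, h.symm _ _ hph⟩, ⟨_, hub, _, rfl, h.symm _ _ hqh⟩,
          _, hub, _, rfl, h.symm _ _ hrh⟩,
        ⟨_, rfl, _, rfl, h.symm _ _ hpd⟩, ⟨_, rfl, _, rfl, h.symm _ _ hqd⟩,
        _, rfl, _, rfl, h.symm _ _ hrd⟩

/-- The inner vertices of the path of a gadget. -/
def innerPath (i : Fin ℓ) (σ : Bool) : Set (Vertex ℓ) :=
  {.copy i (innerP σ)} ∪ {.copy i (innerD σ)} ∪ {.copy i (innerQ σ)}

theorem innerPath_subset {i : Fin ℓ} {σ : Bool} {w : Vertex ℓ} (h : w ∈ innerPath i σ) :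
    ∃ x, IsInner x ∧ w = .copy i x := by
  rcases h with (h | h) | h
  · exact ⟨_, ⟨σ, Or.inl rfl⟩, h⟩
  · exact ⟨_, ⟨σ, Or.inr (Or.inl rfl)⟩, h⟩
  · exact ⟨_, ⟨σ, Or.inr (Or.inr rfl)⟩, h⟩

theorem IsSupportRel.isLinked_innerPath (h : IsSupportRel ℓ S E) (i : Fin ℓ) (σ : Bool) :
    IsLinked E (innerPath i σ) := by
  obtain ⟨-, ⟨-, -, -, hPD, hQD⟩, -⟩ := h.gadget i σ
  exact ((isLinked_singleton E _).union h.symm (isLinked_singleton E _)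
    ⟨_, rfl, _, rfl, hPD⟩).union h.symm (isLinked_singleton E _)
    ⟨_, Or.inr rfl, _, rfl, h.symm _ _ hQD⟩

theorem IsSupportRel.isLinked_reach_union (h : IsSupportRel ℓ S E) (i : Fin ℓ) (σ : Bool)
    {m : Label} (hm : m = innerP σ ∨ m = innerQ σ) :
    IsLinked E (reachThrough E (twinSet ℓ \ S) (.copy i m) ∪ innerPath i σ) := by
  refine (isLinked_reachThrough h.symm _).union h.symm (h.isLinked_innerPath i σ)
    ⟨_, mem_reachThrough_self _, _, Or.inl (Or.inr rfl), ?_⟩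
  obtain ⟨-, ⟨-, -, -, hPD, hQD⟩, -⟩ := h.gadget i σ
  rcases hm with rfl | rfl
  · exact hPD
  · exact hQD

theorem reachThrough_subset {i : Fin ℓ} {m : Label} (hm : IsInner m) {w : Vertex ℓ}
    (hw : w ∈ reachThrough E (twinSet ℓ \ S) (.copy i m)) :
    w ∈ twinSet ℓ ∨ ∃ x, IsInner x ∧ w = .copy i x :=
  (eq_or_mem_of_mem_reachThrough hw).elim (fun h => Or.inr ⟨m, hm, h⟩) fun h => Or.inl h.1

theorem isInner_of_end {m : Label} {σ : Bool} (hm : m = innerP σ ∨ m = innerQ σ) : IsInner m :=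
  ⟨σ, hm.elim Or.inl fun h => Or.inr (Or.inr h)⟩

theorem IsSupportRel.no_escape_reach (h : IsSupportRel ℓ S (ambientAdj G)) (hG : IsPlanar G)
    {i : Fin ℓ} {σ : Bool} {m : Label} (hm : m = innerP σ ∨ m = innerQ σ) {z y : Vertex ℓ}
    (hz : z ∈ reachThrough (ambientAdj G) (twinSet ℓ \ S) (.copy i m)) (hzy : ambientAdj G z y) :
    ¬ (y ∈ restSet ℓ i ∨ y = .copy i (third σ)) := fun hy => by
  refine h.no_escape hG (h.isLinked_reach_union i σ hm) ?_ (Or.inr (Or.inl (Or.inl rfl)))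
    (Or.inr (Or.inl (Or.inr rfl))) (Or.inr (Or.inr rfl)) (Or.inl hz) hzy hy
  rintro w (hw | hw)
  · exact reachThrough_subset (isInner_of_end hm) hw
  · exact Or.inr (innerPath_subset hw)

/-- The hyperedge must connect m to the hub, so an edge leaves the set reached from m. Its far end
is not a surviving twin by maximality, and confinement excludes r, the hub and the other copies.
Only the end o of the same gadget remains. -/
theorem IsSupportRel.adj_of_large (h : IsSupportRel ℓ S (ambientAdj G)) (hG : IsPlanar G)
    (hS : S ⊆ twinSet ℓ) {i : Fin ℓ} {σ : Bool} {m o : Label}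
    (hm : m = innerP σ ∨ m = innerQ σ) (ho : o = endP σ ∨ o = endQ σ)
    (hF : IsLinked (ambientAdj G) (largeEdge ℓ o (third σ) m \ S)) :
    ∃ z ∈ reachThrough (ambientAdj G) (twinSet ℓ \ S) (.copy i m),
      ambientAdj G z (.copy i o) := by
  have hot : o ≠ .t ∧ o ≠ .t' := by
    rcases ho with rfl | rfl <;> cases σ <;> simp [endP, endQ]
  have hrt : third σ ≠ .t ∧ third σ ≠ .t' := by cases σ <;> simp [third]
  have hmt : m ≠ .t ∧ m ≠ .t' := by
    rcases hm with rfl | rfl <;> cases σ <;> simp [innerP, innerQ]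
  have hmS : Vertex.copy i m ∉ S := fun hs => (copy_mem_twinSet.1 (hS hs)).elim hmt.1 hmt.2
  obtain ⟨z, hz, w, hw, hwM, hzw⟩ := hF.exists_exit
    (M := reachThrough (ambientAdj G) (twinSet ℓ \ S) (.copy i m)) (x := .copy i m) (y := .hub)
    ⟨mem_largeEdge.2 (Or.inr (Or.inr (Or.inl ⟨i, rfl⟩))), hmS⟩
    ⟨mem_largeEdge.2 (by simp), fun hs => hub_notMem_twinSet ℓ (hS hs)⟩
    (mem_reachThrough_self _) (fun hh => by
      rcases eq_or_mem_of_mem_reachThrough hh with h' | h'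
      · cases h'
      · exact hub_notMem_twinSet ℓ h'.1)
  have hesc := h.no_escape_reach hG hm hz hzw
  have hrest : ∀ {j x}, x ≠ .t ∧ x ≠ .t' → w = .copy j x → j = i := fun {j x} hx hw => by
    by_contra hj
    exact hesc (Or.inl (Or.inr ⟨j, x, hj, hx.1, hx.2, hw⟩))
  rcases mem_largeEdge.1 hw.1 with ⟨j, e⟩ | ⟨j, e⟩ | ⟨j, e⟩ | hT | e
  · obtain rfl := hrest hot e
    exact ⟨z, hz, e ▸ hzw⟩
  · obtain rfl := hrest hrt e
    exact absurd (Or.inr e) hesc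
  · obtain rfl := hrest hmt e
    exact absurd (e ▸ mem_reachThrough_self _) hwM
  · exact absurd ⟨hT, hw.2⟩ (notMem_of_notMem_reachThrough hz hwM hzw)
  · exact absurd (Or.inl (Or.inl e)) hesc

/-- In every gadget, some vertex of `T` is reached from the first inner vertex of the path. -/
theorem IsSupportRel.exists_common (h : IsSupportRel ℓ S (ambientAdj G)) (hG : IsPlanar G)
    (hS : S ⊆ twinSet ℓ) (i : Fin ℓ) (σ : Bool) : ∃ t ∈ twinSet ℓ \ S,
      t ∈ reachThrough (ambientAdj G) (twinSet ℓ \ S) (.copy i (innerP σ)) := by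
  have h1 := h.adj_of_large hG hS (i := i) (σ := σ) (m := innerP σ) (o := endQ σ) (Or.inl rfl)
    (Or.inr rfl) (h.large _ _ _ (by cases σ <;> simp [largeTriples, endQ, third, innerP]))
  have h2 := h.adj_of_large hG hS (i := i) (σ := σ) (m := innerQ σ) (o := endP σ) (Or.inr rfl)
    (Or.inl rfl) (h.large _ _ _ (by cases σ <;> simp [largeTriples, endP, third, innerQ]))
  obtain ⟨⟨hpq, hpd, hqd, hrd, hrp, hrq⟩, ⟨hPp, hQq, hDd, hPD, hQD⟩, -⟩ := h.gadget i σ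
  have hp : endP σ = .a ∨ endP σ = .b ∨ endP σ = .c ∨ endP σ = .d := by cases σ <;> simp [endP]
  have hq : endQ σ = .a ∨ endQ σ = .b ∨ endQ σ = .c ∨ endQ σ = .d := by cases σ <;> simp [endQ]
  have npq : endP σ ≠ endQ σ := by cases σ <;> simp [endP, endQ]
  have npd : endP σ ≠ .d := by cases σ <;> simp [endP]
  have nqd : endQ σ ≠ .d := by cases σ <;> simp [endQ]
  have iP : IsInner (innerP σ) := ⟨σ, Or.inl rfl⟩
  have iD : IsInner (innerD σ) := ⟨σ, Or.inr (Or.inl rfl)⟩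
  have iQ : IsInner (innerQ σ) := ⟨σ, Or.inr (Or.inr rfl)⟩
  have tD : innerD σ ≠ .t ∧ innerD σ ≠ .t' := by cases σ <;> simp [innerD]
  have sing := isLinked_singleton (ambientAdj G)
  set M := reachThrough (ambientAdj G) (twinSet ℓ \ S) (.copy i (innerP σ)) with hM
  set N := reachThrough (ambientAdj G) (twinSet ℓ \ S) (.copy i (innerQ σ)) with hN
  have hMi : ∀ w ∈ M, w ∈ twinSet ℓ ∨ ∃ x, IsInner x ∧ w = .copy i x := fun w hw =>
    reachThrough_subset iP hw
  have hNi : ∀ w ∈ N, w ∈ twinSet ℓ ∨ ∃ x, IsInner x ∧ w = .copy i x := fun w hw =>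
    reachThrough_subset iQ hw
  have hDi : ∀ w ∈ ({.copy i (innerD σ)} : Set (Vertex ℓ)),
      w ∈ twinSet ℓ ∨ ∃ x, IsInner x ∧ w = .copy i x := fun w hw => Or.inr ⟨_, iD, hw⟩
  have hMD : Disjoint {.copy i (innerD σ)} M := by
    rw [Set.disjoint_singleton_left]
    intro hw
    rcases eq_or_mem_of_mem_reachThrough hw with e | e
    · cases σ <;> cases e
    · exact (copy_mem_twinSet.1 e.1).elim tD.1 tD.2
  have hND : Disjoint {.copy i (innerD σ)} N := by
    rw [Set.disjoint_singleton_left]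
    intro hw
    rcases eq_or_mem_of_mem_reachThrough hw with e | e
    · cases σ <;> cases e
    · exact (copy_mem_twinSet.1 e.1).elim tD.1 tD.2
  by_contra hno
  push Not at hno
  -- The two roots have different labels, neither of them a twin label, so a common vertex would be
  -- a twin in M.
  have hMN : Disjoint M N := by
    rw [Set.disjoint_left]
    intro w hwM hwN
    rcases eq_or_mem_of_mem_reachThrough hwM with rfl | e
    · rcases eq_or_mem_of_mem_reachThrough hwN with e | e
      · cases σ <;> cases e
      · exact hno _ e hwM
    · exact hno _ e hwM
  obtain ⟨z, hz, hzq⟩ := h1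
  obtain ⟨y, hy, hyp⟩ := h2
  -- Branch sets {D, p, q} against {M, N, d}. The pairs p, N and q, M come from the large
  -- hyperedges, all others from hyperedges of size two.
  refine hG.no_ambient_bipartite_minor (sing (.copy i (innerD σ))) (sing (.copy i (endP σ)))
    (sing (.copy i (endQ σ))) (isLinked_reachThrough h.symm _ : IsLinked _ M)
    (isLinked_reachThrough h.symm _ : IsLinked _ N) (sing (.copy i .d)) ?_ ?_
  · simp only [List.pairwise_cons, List.mem_cons, List.not_mem_nil, or_false, forall_eq_or_imp,
      forall_eq, IsEmpty.forall_iff, implies_true, and_true, List.Pairwise.nil]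
    exact ⟨⟨disjoint_singleton_of_inner hDi hp, disjoint_singleton_of_inner hDi hq, hMD, hND,
      disjoint_singleton_of_inner hDi (by simp)⟩,
      ⟨disjoint_copy i npq, (disjoint_singleton_of_inner hMi hp).symm,
        (disjoint_singleton_of_inner hNi hp).symm, disjoint_copy i npd⟩,
      ⟨(disjoint_singleton_of_inner hMi hq).symm, (disjoint_singleton_of_inner hNi hq).symm,
        disjoint_copy i nqd⟩,
      ⟨hMN, disjoint_singleton_of_inner hMi (by simp)⟩, disjoint_singleton_of_inner hNi (by simp)⟩
  · simp only [List.mem_cons, List.not_mem_nil, or_false, forall_eq_or_imp, forall_eq]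
    have sP : .copy i (innerP σ) ∈ M := mem_reachThrough_self _
    have sQ : .copy i (innerQ σ) ∈ N := mem_reachThrough_self _
    exact ⟨⟨⟨_, rfl, _, sP, h.symm _ _ hPD⟩, ⟨_, rfl, _, sQ, h.symm _ _ hQD⟩, _, rfl, _, rfl, hDd⟩,
      ⟨⟨_, rfl, _, sP, h.symm _ _ hPp⟩, ⟨_, rfl, _, hy, h.symm _ _ hyp⟩, _, rfl, _, rfl, hpd⟩,
      ⟨_, rfl, _, hz, h.symm _ _ hzq⟩, ⟨_, rfl, _, sQ, h.symm _ _ hQq⟩, _, rfl, _, rfl, hqd⟩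

/-- No vertex of `T` serves two gadgets. -/
theorem IsSupportRel.eq_of_common (h : IsSupportRel ℓ S (ambientAdj G)) (hG : IsPlanar G)
    {i j : Fin ℓ} {σ τ : Bool} {t : Vertex ℓ} (ht : t ∈ twinSet ℓ \ S)
    (h1 : t ∈ reachThrough (ambientAdj G) (twinSet ℓ \ S) (.copy i (innerP σ)))
    (h2 : t ∈ reachThrough (ambientAdj G) (twinSet ℓ \ S) (.copy j (innerP τ))) :
    i = j ∧ σ = τ := by
  have htt : innerP τ ≠ .t ∧ innerP τ ≠ .t' := by cases τ <;> simp [innerP]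
  obtain ⟨z, hz, hzw⟩ := exists_adj_of_mem_reachThrough h.symm ht
    (fun hw => (copy_mem_twinSet.1 hw.1).elim htt.1 htt.2) h1 h2
  have hij : i = j := by
    by_contra hij
    exact h.no_escape_reach hG (Or.inl rfl) hz hzw
      (Or.inl (Or.inr ⟨j, _, Ne.symm hij, htt.1, htt.2, rfl⟩))
  subst hij
  refine ⟨rfl, ?_⟩
  by_contra hστ
  -- The shared twin glues the two paths of the copy into one connected set. The second path touches
  -- the corner r of the first gadget (va sees a, uc sees c), which confinement forbids.
  have hl := (h.isLinked_reach_union i σ (Or.inl rfl)).union h.symm (h.isLinked_innerPath i τ)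
    ⟨z, Or.inl hz, _, Or.inl (Or.inl rfl), hzw⟩
  have hW : ∀ w ∈ (reachThrough (ambientAdj G) (twinSet ℓ \ S) (.copy i (innerP σ)) ∪
      innerPath i σ) ∪ innerPath i τ, w ∈ twinSet ℓ ∨ ∃ x, IsInner x ∧ w = .copy i x := by
    rintro w ((hw | hw) | hw)
    · exact reachThrough_subset ⟨σ, Or.inl rfl⟩ hw
    · exact Or.inr (innerPath_subset hw)
    · exact Or.inr (innerPath_subset hw)
  have hex : ∃ x, .copy i x ∈ innerPath i τ ∧ ambientAdj G (.copy i x) (.copy i (third σ)) := by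
    cases σ <;> cases τ
    · exact absurd rfl hστ
    · exact ⟨.va, Or.inl (Or.inl rfl), h.solid' _ _ _ (by simp [third, solidPairs])⟩
    · exact ⟨.uc, Or.inr rfl, h.solid' _ _ _ (by simp [third, solidPairs])⟩
    · exact absurd rfl hστ
  obtain ⟨x, hx, hxr⟩ := hex
  exact h.no_escape hG hl hW (Or.inl (Or.inr (Or.inl (Or.inl rfl))))
    (Or.inl (Or.inr (Or.inl (Or.inr rfl)))) (Or.inl (Or.inr (Or.inr rfl))) (Or.inr hx) hxr
    (Or.inr rfl)

/-! ### Counting gadgets against twins -/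

/-- The number of a label. -/
def labelIndex : Label → Fin 12
  | .a => 0 | .b => 1 | .c => 2 | .d => 3 | .va => 4 | .vb => 5 | .vd => 6 | .ub => 7
  | .uc => 8 | .ud => 9 | .t => 10 | .t' => 11

theorem labelIndex_injective : Function.Injective labelIndex := fun x y h => by
  cases x <;> cases y <;> first | rfl | simp [labelIndex] at h

instance : DecidableEq Label := fun _ _ => decidable_of_iff _ labelIndex_injective.eq_iff

instance : Finite (Vertex ℓ) := by
  have : Finite Label := Finite.of_injective labelIndex labelIndex_injective
  exact Finite.of_injective
    (fun w : Vertex ℓ => (match w with | .hub => none | .copy i x => some (i, x) :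
      Option (Fin ℓ × Label)))
    (fun x y => by cases x <;> cases y <;> simp)

theorem ncard_twinSet (ℓ : ℕ) : (twinSet ℓ).ncard = 2 * ℓ := by
  have : twinSet ℓ = Set.range (fun z : Fin ℓ × Bool =>
      Vertex.copy z.1 (if z.2 then .t else .t')) := by
    ext w
    rw [mem_twinSet]
    constructor
    · rintro ⟨i, rfl | rfl⟩
      · exact ⟨(i, true), rfl⟩
      · exact ⟨(i, false), rfl⟩
    · rintro ⟨⟨i, _ | _⟩, rfl⟩
      · exact ⟨i, Or.inr rfl⟩
      · exact ⟨i, Or.inl rfl⟩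
  rw [this, ← Set.image_univ, Set.ncard_image_of_injective _ (fun x y => by
    obtain ⟨i, σ⟩ := x
    obtain ⟨j, τ⟩ := y
    cases σ <;> cases τ <;> simp), Set.ncard_univ]
  simp [mul_comm]

/-- Choosing a twin for each gadget is an injection of the 2ℓ gadgets into the surviving twins,
which leaves no room for a removed one. -/
theorem IsSupportRel.not_nonempty (h : IsSupportRel ℓ S (ambientAdj G)) (hG : IsPlanar G)
    (hS : S ⊆ twinSet ℓ) : ¬ S.Nonempty := by
  intro hne
  choose f hf hf' using fun z : Fin ℓ × Bool => h.exists_common hG hS z.1 z.2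
  have hinj : Function.Injective f := fun x y e => by
    obtain ⟨h1, h2⟩ := h.eq_of_common hG (hf x) (hf' x) (e ▸ hf' y)
    exact Prod.ext h1 h2
  have h1 : 2 * ℓ ≤ (twinSet ℓ \ S).ncard := by
    have : (Set.range f).ncard ≤ (twinSet ℓ \ S).ncard :=
      Set.ncard_le_ncard (by rintro _ ⟨z, rfl⟩; exact hf z) (Set.toFinite _)
    rw [← Set.image_univ, Set.ncard_image_of_injective _ hinj, Set.ncard_univ] at this
    simpa [mul_comm] using this
  have h2 : (twinSet ℓ \ S).ncard < (twinSet ℓ).ncard := by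
    obtain ⟨x, hx⟩ := hne
    exact Set.ncard_lt_ncard ⟨Set.sdiff_subset, fun hh => (hh (hS hx)).2 hx⟩ (Set.toFinite _)
  rw [ncard_twinSet] at h2
  omega

end support

/-! ### From supports to their adjacency relations -/

/-- A hyperedge with at least two elements is linked by the adjacency relation of a support. -/
theorem IsSupport.isLinked {α : Type*} {H : Hypergraph α} {G : SimpleGraph H.vertexSet}
    (h : IsSupport H G) {F : Set α} (hF : F ∈ H.edgeSet) : IsLinked (ambientAdj G) F := by
  intro x hx y hy
  have hsub := H.subset_vertexSet_of_mem_edgeSet' hF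
  have hr := (h F hF).preconnected ⟨⟨x, hsub hx⟩, hx⟩ ⟨⟨y, hsub hy⟩, hy⟩
  rw [SimpleGraph.reachable_iff_reflTransGen] at hr
  exact Relation.ReflTransGen.lift
    (fun v : {v : H.vertexSet | (v : α) ∈ F} => ((v : H.vertexSet) : α)) (fun u v huv =>
    ⟨⟨u.1.2, v.1.2, huv⟩, u.2, v.2⟩) _ _ hr

theorem isSupportRel_of_isSupport {ℓ : ℕ} {S : Set (Vertex ℓ)} (hℓ : 1 ≤ ℓ) (hS : S ⊆ twinSet ℓ)
    {G : SimpleGraph (removeVertices (twinHypergraph ℓ) S).vertexSet}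
    (h : IsSupport (removeVertices (twinHypergraph ℓ) S) G) :
    IsSupportRel ℓ S (ambientAdj G) := by
  have irrefl : ∀ x, ¬ ambientAdj G x x := fun x ⟨_, _, hx⟩ => G.irrefl hx
  have pair : ∀ u v, u ≠ v → u ∉ twinSet ℓ → v ∉ twinSet ℓ →
      ({u, v} : Set (Vertex ℓ)) ∈ (twinHypergraph ℓ).edgeSet → ambientAdj G u v := by
    intro u v huv hu hv hF
    refine IsLinked.adj_of_pair irrefl huv (h.isLinked ⟨⟨_, hF, ?_⟩, Set.nontrivial_pair huv⟩)
    rw [eq_comm, sdiff_eq_left, Set.disjoint_left]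
    rintro w (rfl | rfl) hw
    · exact hu (hS hw)
    · exact hv (hS hw)
  refine ⟨ambientAdj.symm, fun i x y hxy => ?_, fun i x hx => ?_, fun x y z hxyz => ?_⟩
  · have : x ≠ y ∧ (x ≠ .t ∧ x ≠ .t') ∧ (y ≠ .t ∧ y ≠ .t') := by
      simp only [solidPairs, Set.mem_insert_iff, Set.mem_singleton_iff, Prod.mk.injEq] at hxy
      rcases hxy with ⟨rfl, rfl⟩ | ⟨rfl, rfl⟩ | ⟨rfl, rfl⟩ | ⟨rfl, rfl⟩ | ⟨rfl, rfl⟩ | ⟨rfl, rfl⟩ |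
        ⟨rfl, rfl⟩ | ⟨rfl, rfl⟩ | ⟨rfl, rfl⟩ | ⟨rfl, rfl⟩ | ⟨rfl, rfl⟩ | ⟨rfl, rfl⟩ |
        ⟨rfl, rfl⟩ | ⟨rfl, rfl⟩ | ⟨rfl, rfl⟩ | ⟨rfl, rfl⟩ <;> simp
    exact pair _ _ (by simpa using this.1) (by simpa [copy_mem_twinSet] using this.2.1)
      (by simpa [copy_mem_twinSet] using this.2.2) (Or.inl (Or.inl ⟨i, x, y, hxy, rfl⟩))
  · exact pair _ _ (by simp) (by rw [copy_mem_twinSet]; rcases hx with rfl | rfl | rfl <;> simp)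
      (hub_notMem_twinSet ℓ) (Or.inl (Or.inr ⟨i, x, hx, rfl⟩))
  · refine h.isLinked ⟨⟨_, Or.inr ⟨x, y, z, hxyz, rfl⟩, rfl⟩, ?_⟩
    have hx : x ≠ .t ∧ x ≠ .t' := by
      simp only [largeTriples, Set.mem_insert_iff, Set.mem_singleton_iff, Prod.mk.injEq] at hxyz
      rcases hxyz with ⟨rfl, -⟩ | ⟨rfl, -⟩ | ⟨rfl, -⟩ | ⟨rfl, -⟩ | ⟨rfl, -⟩ | ⟨rfl, -⟩ |
        ⟨rfl, -⟩ | ⟨rfl, -⟩ <;> simp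
    -- A trimmed large hyperedge is kept because it still contains the hub and a non-twin vertex of
    -- the copy with index 0; this is where ℓ ≥ 1 enters.
    exact ⟨.copy ⟨0, hℓ⟩ x, ⟨mem_largeEdge.2 (Or.inl ⟨_, rfl⟩),
        fun hs => (copy_mem_twinSet.1 (hS hs)).elim hx.1 hx.2⟩,
      .hub, ⟨mem_largeEdge.2 (by simp), fun hs => hub_notMem_twinSet ℓ (hS hs)⟩, by simp⟩

theorem not_hasPlanarSupport_removeVertices {ℓ : ℕ} (hℓ : 1 ≤ ℓ) {S : Set (Vertex ℓ)}
    (hS : S ⊆ twinSet ℓ) (hne : S.Nonempty) :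
    ¬ HasPlanarSupport (removeVertices (twinHypergraph ℓ) S) := by
  rintro ⟨G, hsupp, hG⟩
  exact (isSupportRel_of_isSupport hℓ hS hsupp).not_nonempty hG hS hne

/-! ### Straight-line drawings -/

theorem isArcBetween_segment {x y : Plane} (h : x ≠ y) : IsArcBetween x y (segment ℝ x y) := by
  refine ⟨fun t => AffineMap.lineMap x y (t : ℝ), ?_, by simp, by simp, ?_⟩
  · refine (Continuous.isClosedEmbedding (by fun_prop) fun s t hst => ?_).isEmbedding
    exact Subtype.ext (AffineMap.lineMap_injective ℝ h hst)
  · rw [segment_eq_image_lineMap]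
    ext z
    simp [unitInterval]

/-- A straight-line drawing without crossings is a plane embedding. -/
theorem isPlanar_of_segments {V : Type*} (G : SimpleGraph V) (φ : V → Plane)
    (hφ : Function.Injective φ) (hdeg : ∀ w, ∃ w', G.Adj w w')
    (hcross : ∀ u v u' v', G.Adj u v → G.Adj u' v' → ¬ (u = u' ∧ v = v') → ¬ (u = v' ∧ v = u') →
      ∀ z ∈ segment ℝ (φ u) (φ v), z ∈ segment ℝ (φ u') (φ v') → z = φ u ∨ z = φ v) :
    IsPlanar G := by
  -- No separate check for vertices on edges is needed: every vertex is the end of some segment, so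
  -- the crossing condition covers it.
  have hmem : ∀ u v w, G.Adj u v → φ w ∈ segment ℝ (φ u) (φ v) → w = u ∨ w = v := by
    intro u v w huv hw
    by_contra hne
    push Not at hne
    obtain ⟨w', hw'⟩ := hdeg w
    rcases hcross u v w w' huv hw' (fun h => hne.1 h.1.symm) (fun h => hne.2 h.2.symm) _ hw
      (left_mem_segment ℝ _ _) with h | h
    · exact hne.1 (hφ h)
    · exact hne.2 (hφ h)
  refine ⟨φ, {S | ∃ u v, G.Adj u v ∧ S = segment ℝ (φ u) (φ v)}, hφ, ?_, ?_⟩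
  · rintro _ ⟨u, v, huv, rfl⟩
    refine ⟨u, v, isArcBetween_segment fun h => huv.ne (hφ h), fun w hw => ?_, ?_⟩
    · rcases hmem u v w huv hw.1 with rfl | rfl
      · exact hw.2 (Or.inl rfl)
      · exact hw.2 (Or.inr rfl)
    · rintro _ ⟨u', v', huv', rfl⟩ hne
      rw [Set.disjoint_left]
      intro z hz hz'
      refine hz.2 (hcross u v u' v' huv huv' ?_ ?_ z hz.1 hz')
      · rintro ⟨rfl, rfl⟩
        exact hne rfl
      · rintro ⟨rfl, rfl⟩
        exact hne (segment_symm ℝ _ _)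
  · refine fun u v => ⟨fun huv => ⟨_, ⟨u, v, huv, rfl⟩,
      isArcBetween_segment fun h => huv.ne (hφ h)⟩, ?_⟩
    rintro ⟨_, ⟨u', v', huv, rfl⟩, hA⟩
    have hne : u ≠ v := fun h => hA.ne (congrArg φ h)
    rcases hmem _ _ _ huv hA.left_mem with rfl | rfl <;>
      rcases hmem _ _ _ huv hA.right_mem with rfl | rfl
    exacts [absurd rfl hne, huv, huv.symm, absurd rfl hne]

/-- Twice the signed area of the triangle with the given corners. -/
def orient {R : Type*} [Ring R] (px py qx qy rx ry : R) : R :=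
  (qx - px) * (ry - py) - (qy - py) * (rx - px)

theorem orient_of_mem_segment (p q : Plane) {r s : Plane} {a b : ℝ} (hab : a + b = 1) :
    orient (p 0) (p 1) (q 0) (q 1) ((a • r + b • s : Plane) 0) ((a • r + b • s : Plane) 1) =
      a * orient (p 0) (p 1) (q 0) (q 1) (r 0) (r 1) +
      b * orient (p 0) (p 1) (q 0) (q 1) (s 0) (s 1) := by
  obtain rfl : a = 1 - b := by linarith
  simp only [orient, PiLp.add_apply, PiLp.smul_apply, smul_eq_mul]
  ring

theorem orient_eq_zero_of_mem_segment {p q z : Plane} (hz : z ∈ segment ℝ p q) :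
    orient (p 0) (p 1) (q 0) (q 1) (z 0) (z 1) = 0 := by
  obtain ⟨a, b, -, -, hab, rfl⟩ := hz
  rw [orient_of_mem_segment p q hab]
  simp only [orient]
  ring

theorem orient_ne_zero_of_mem_segment (p q : Plane) {r s z : Plane} (hz : z ∈ segment ℝ r s)
    (h : 0 < orient (p 0) (p 1) (q 0) (q 1) (r 0) (r 1) ∧
        0 < orient (p 0) (p 1) (q 0) (q 1) (s 0) (s 1) ∨
      orient (p 0) (p 1) (q 0) (q 1) (r 0) (r 1) < 0 ∧
        orient (p 0) (p 1) (q 0) (q 1) (s 0) (s 1) < 0) :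
    orient (p 0) (p 1) (q 0) (q 1) (z 0) (z 1) ≠ 0 := by
  obtain ⟨a, b, ha, hb, hab, rfl⟩ := hz
  rw [orient_of_mem_segment p q hab]
  obtain rfl : a = 1 - b := by linarith
  rcases h with ⟨h1, h2⟩ | ⟨h1, h2⟩
  · rcases hb.eq_or_lt with rfl | hb
    · simpa using h1.ne'
    · have := mul_nonneg ha h1.le
      have := mul_pos hb h2
      linarith
  · rcases hb.eq_or_lt with rfl | hb
    · simpa using h1.ne
    · have := mul_nonpos_of_nonneg_of_nonpos ha h1.le
      have := mul_neg_of_pos_of_neg hb h2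
      linarith

theorem eq_of_mem_segments_of_orient_ne_zero {p q s z : Plane} (r : Plane)
    (hz : z ∈ segment ℝ p q) (hz' : z ∈ segment ℝ r s)
    (hr : orient (p 0) (p 1) (q 0) (q 1) (r 0) (r 1) = 0)
    (hs : orient (p 0) (p 1) (q 0) (q 1) (s 0) (s 1) ≠ 0) : z = r := by
  have h0 := orient_eq_zero_of_mem_segment hz
  obtain ⟨a, b, -, -, hab, rfl⟩ := hz'
  rw [orient_of_mem_segment p q hab, hr, mul_zero, zero_add] at h0
  obtain rfl : b = 0 := (mul_eq_zero.1 h0).resolve_right hs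
  obtain rfl : a = 1 := by linarith
  simp

/-! ### The planar support -/

/-- The vertices of a copy together with the hub, which is `none`. -/
abbrev LocalVertex : Type := Option Label

/-- The coordinates of the vertices in a drawing of a copy inside the cone `0 < y < x` with the
hub at the origin. -/
def localCoord : LocalVertex → ℤ × ℤ
  | none => (0, 0)
  | some .a => (15, 1) | some .b => (8, 4) | some .c => (15, 14) | some .d => (13, 6)
  | some .va => (13, 3) | some .vd => (12, 5) | some .vb => (10, 4) | some .t => (11, 3)
  | some .ub => (10, 6) | some .ud => (12, 7) | some .uc => (13, 9) | some .t' => (11, 8)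

/-- The edges of the support inside a copy and to the hub. -/
def localEdges : List (LocalVertex × LocalVertex) :=
  [(some .a, some .b), (some .a, some .c), (some .a, some .d), (some .b, some .c),
    (some .b, some .d), (some .c, some .d), (some .a, some .va), (some .va, some .vd),
    (some .vd, some .vb), (some .vb, some .b), (some .vd, some .d), (some .b, some .ub),
    (some .ub, some .ud), (some .ud, some .uc), (some .uc, some .c), (some .ud, some .d),
    (some .a, none), (some .b, none), (some .c, none), (some .t, some .a), (some .t, some .va),
    (some .t, some .vb), (some .t, some .b), (some .t', some .b), (some .t', some .ub),
    (some .t', some .uc), (some .t', some .c)]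

/-- The orientation of three local vertices. -/
def localOrient (p q r : LocalVertex) : ℤ :=
  orient (localCoord p).1 (localCoord p).2 (localCoord q).1 (localCoord q).2
    (localCoord r).1 (localCoord r).2

/-- The segments `e` and `f` are separated by the line through one of them, or they have a common
endpoint and different directions. -/
def Uncrossed (e f : LocalVertex × LocalVertex) : Prop :=
  (0 < localOrient e.1 e.2 f.1 ∧ 0 < localOrient e.1 e.2 f.2 ∨
    localOrient e.1 e.2 f.1 < 0 ∧ localOrient e.1 e.2 f.2 < 0) ∨
  (0 < localOrient f.1 f.2 e.1 ∧ 0 < localOrient f.1 f.2 e.2 ∨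
    localOrient f.1 f.2 e.1 < 0 ∧ localOrient f.1 f.2 e.2 < 0) ∨
  ((f.1 = e.1 ∨ f.1 = e.2) ∧ localOrient e.1 e.2 f.2 ≠ 0) ∨
  ((f.2 = e.1 ∨ f.2 = e.2) ∧ localOrient e.1 e.2 f.1 ≠ 0)

instance (e f : LocalVertex × LocalVertex) : Decidable (Uncrossed e f) := by
  unfold Uncrossed
  infer_instance

/-- The only geometric verification for the drawing inside a copy, in integer arithmetic; shears
carry it to all copies. -/
theorem uncrossed_localEdges : ∀ e ∈ localEdges, ∀ f ∈ localEdges, e ≠ f → Uncrossed e f := by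
  decide +kernel

theorem ne_of_mem_localEdges : ∀ e ∈ localEdges, e.1 ≠ e.2 := by decide +kernel

/-- Adjacency of local vertices. -/
def LocalAdj (x y : LocalVertex) : Prop := (x, y) ∈ localEdges ∨ (y, x) ∈ localEdges

instance (x y : LocalVertex) : Decidable (LocalAdj x y) := by
  unfold LocalAdj
  infer_instance

theorem localCoord_cone (x : Label) :
    0 < (localCoord (some x)).2 ∧ (localCoord (some x)).2 < (localCoord (some x)).1 := by
  cases x <;> decide

theorem localCoord_injective : Function.Injective localCoord := by
  rintro (_ | x) (_ | y) h
  · rfl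
  · cases y <;> simp [localCoord] at h
  · cases x <;> simp [localCoord] at h
  · cases x <;> cases y <;> first | rfl | simp [localCoord] at h

variable {ℓ : ℕ}

/-- The vertex of the `i`-th copy, or the hub, given by a local vertex. -/
def ofLocal (i : Fin ℓ) : LocalVertex → Vertex ℓ
  | none => .hub
  | some x => .copy i x

theorem ofLocal_injective (i : Fin ℓ) : Function.Injective (ofLocal i) := by
  rintro (_ | x) (_ | y) h <;> simp_all [ofLocal]

/-- The support, as a graph on all vertices. -/
def supportGraph (ℓ : ℕ) : SimpleGraph (Vertex ℓ) where
  Adj u v := ∃ (i : Fin ℓ) (x y : LocalVertex), LocalAdj x y ∧ u = ofLocal i x ∧ v = ofLocal i y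
  symm := ⟨by
    rintro u v ⟨i, x, y, h, hu, hv⟩
    exact ⟨i, y, x, h.symm, hv, hu⟩⟩
  loopless := ⟨by
    rintro u ⟨i, x, y, h, rfl, hv⟩
    obtain rfl := ofLocal_injective i hv
    rcases h with h | h <;> exact ne_of_mem_localEdges _ h rfl⟩

/-- The positions of the vertices: the `i`-th copy is sheared into the cone `i x < y < (i+1) x`. -/
def position : Vertex ℓ → Plane
  | .hub => 0
  | .copy i x => !₂[((localCoord (some x)).1 : ℝ),
      ((localCoord (some x)).2 : ℝ) + (i : ℕ) * ((localCoord (some x)).1 : ℝ)]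

theorem position_ofLocal_zero (i : Fin ℓ) (x : LocalVertex) :
    position (ofLocal i x) 0 = (localCoord x).1 := by
  cases x <;> simp [ofLocal, position, localCoord]

theorem position_ofLocal_one (i : Fin ℓ) (x : LocalVertex) :
    position (ofLocal i x) 1 = (localCoord x).2 + (i : ℕ) * (localCoord x).1 := by
  cases x <;> simp [ofLocal, position, localCoord]

/-- The shear (x, y) ↦ (x, y + i x) has determinant 1, so orientations do not depend on the copy. -/
theorem orient_position (i : Fin ℓ) (p q r : LocalVertex) :
    orient (position (ofLocal i p) 0) (position (ofLocal i p) 1) (position (ofLocal i q) 0)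
      (position (ofLocal i q) 1) (position (ofLocal i r) 0) (position (ofLocal i r) 1) =
      (localOrient p q r : ℝ) := by
  simp only [position_ofLocal_zero, position_ofLocal_one, orient, localOrient]
  push_cast
  ring

/-- The open cone that contains the `i`-th copy. -/
def cone (i : ℕ) : Set Plane := {z | 0 < z 0 ∧ i * z 0 < z 1 ∧ z 1 < (i + 1) * z 0}

theorem position_copy_mem_cone (i : Fin ℓ) (x : Label) : position (.copy i x) ∈ cone (i : ℕ) := by
  obtain ⟨h1, h2⟩ := localCoord_cone x
  have h1' : (0 : ℝ) < (localCoord (some x)).2 := by exact_mod_cast h1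
  have h2' : ((localCoord (some x)).2 : ℝ) < (localCoord (some x)).1 := by exact_mod_cast h2
  have e0 := position_ofLocal_zero i (some x)
  have e1 := position_ofLocal_one i (some x)
  simp only [ofLocal] at e0 e1
  refine ⟨?_, ?_, ?_⟩ <;> simp only [e0, e1] <;> linarith

theorem cone_smul_add {i : ℕ} {x y : Plane} (hx : x ∈ cone i) (hy : y ∈ cone i ∨ y = 0) {a b : ℝ}
    (ha : 0 < a) (hb : 0 ≤ b) : a • x + b • y ∈ cone i := by
  obtain ⟨h1, h2, h3⟩ := hx
  have g1 := mul_pos ha h1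
  have g2 := mul_pos ha (sub_pos.2 h2)
  have g3 := mul_pos ha (sub_pos.2 h3)
  rcases hy with ⟨k1, k2, k3⟩ | rfl
  · have l1 := mul_nonneg hb k1.le
    have l2 := mul_nonneg hb (sub_pos.2 k2).le
    have l3 := mul_nonneg hb (sub_pos.2 k3).le
    refine ⟨?_, ?_, ?_⟩ <;> simp only [PiLp.add_apply, PiLp.smul_apply, smul_eq_mul] <;> linarith
  · refine ⟨?_, ?_, ?_⟩ <;> simp only [PiLp.add_apply, PiLp.smul_apply, smul_eq_mul,
      PiLp.zero_apply, mul_zero, add_zero] <;> linarith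

theorem eq_of_mem_cone {i j : ℕ} {z : Plane} (hi : z ∈ cone i) (hj : z ∈ cone j) : i = j := by
  have key : ∀ {i j : ℕ}, z ∈ cone i → z ∈ cone j → i ≤ j := by
    rintro i j ⟨h0, h1, -⟩ ⟨-, -, h2⟩
    have : (i : ℝ) < j + 1 := lt_of_mul_lt_mul_right (h1.trans h2) h0.le
    exact Nat.lt_succ_iff.1 (by exact_mod_cast this)
  exact le_antisymm (key hi hj) (key hj hi)

theorem zero_notMem_cone (i : ℕ) : (0 : Plane) ∉ cone i := fun h => by simpa using h.1

theorem position_ofLocal_mem (i : Fin ℓ) (x : LocalVertex) :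
    position (ofLocal i x) ∈ cone (i : ℕ) ∨ x = none := by
  rcases x with _ | x
  · exact Or.inr rfl
  · exact Or.inl (position_copy_mem_cone i x)

/-- A point on an edge of the `i`-th copy lies in the `i`-th cone, or it is the hub. -/
theorem mem_cone_of_mem_segment {i : Fin ℓ} {x y : LocalVertex} (hxy : LocalAdj x y) {z : Plane}
    (hz : z ∈ segment ℝ (position (ofLocal i x)) (position (ofLocal i y))) :
    z ∈ cone (i : ℕ) ∨ z = 0 ∧ (x = none ∨ y = none) := by
  have h0 : position (ofLocal i none) = 0 := rfl
  obtain ⟨a, b, ha, hb, hab, rfl⟩ := hz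
  rcases position_ofLocal_mem i x with hx | rfl
  · rcases ha.eq_or_lt with rfl | ha
    · obtain rfl : b = 1 := by linarith
      rcases position_ofLocal_mem i y with hy | rfl
      · left
        simpa using hy
      · right
        simp [h0]
    · refine Or.inl (cone_smul_add hx ?_ ha hb)
      rcases position_ofLocal_mem i y with hy | rfl
      · exact Or.inl hy
      · exact Or.inr h0
  · rcases position_ofLocal_mem i y with hy | rfl
    · rcases hb.eq_or_lt with rfl | hb
      · right
        simp [h0]
      · left
        rw [add_comm]
        exact cone_smul_add hy (Or.inr h0) hb ha
    · rcases hxy with h | h <;> exact absurd rfl (ne_of_mem_localEdges _ h)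

theorem position_injective : Function.Injective (position : Vertex ℓ → Plane) := by
  rintro (_ | ⟨i, x⟩) (_ | ⟨j, y⟩) h
  · rfl
  · exact absurd (h ▸ position_copy_mem_cone j y : (0 : Plane) ∈ cone _) (zero_notMem_cone _)
  · exact absurd (h ▸ position_copy_mem_cone i x : (0 : Plane) ∈ cone _) (zero_notMem_cone _)
  · have hij : i = j := Fin.ext (eq_of_mem_cone (position_copy_mem_cone i x)
      (h ▸ position_copy_mem_cone j y))
    subst hij
    have e0 := congrArg (fun z : Plane => z 0) h
    have e1 := congrArg (fun z : Plane => z 1) h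
    have x0 := position_ofLocal_zero i (some x)
    have x1 := position_ofLocal_one i (some x)
    have y0 := position_ofLocal_zero i (some y)
    have y1 := position_ofLocal_one i (some y)
    simp only [ofLocal] at x0 x1 y0 y1
    simp only [x0, x1, y0, y1] at e0 e1
    rw [e0, add_left_inj] at e1
    have := localCoord_injective (a₁ := some x) (a₂ := some y)
      (Prod.ext (by exact_mod_cast e0) (by exact_mod_cast e1))
    rw [Option.some.inj this]

theorem eq_of_uncrossed {i : Fin ℓ} {e f : LocalVertex × LocalVertex} (h : Uncrossed e f)
    {z : Plane} (hz : z ∈ segment ℝ (position (ofLocal i e.1)) (position (ofLocal i e.2)))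
    (hz' : z ∈ segment ℝ (position (ofLocal i f.1)) (position (ofLocal i f.2))) :
    z = position (ofLocal i e.1) ∨ z = position (ofLocal i e.2) := by
  have end1 : localOrient e.1 e.2 e.1 = 0 := by simp [localOrient, orient]
  have end2 : localOrient e.1 e.2 e.2 = 0 := by simp only [localOrient, orient]; ring
  rcases h with h | h | ⟨h, hne⟩ | ⟨h, hne⟩
  · refine absurd (orient_eq_zero_of_mem_segment hz) (orient_ne_zero_of_mem_segment _ _ hz' ?_)
    simp only [orient_position]
    exact_mod_cast h
  · refine absurd (orient_eq_zero_of_mem_segment hz') (orient_ne_zero_of_mem_segment _ _ hz ?_)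
    simp only [orient_position]
    exact_mod_cast h
  · have hr : localOrient e.1 e.2 f.1 = 0 := by
      rcases h with h | h <;> rw [h] <;> assumption
    have := eq_of_mem_segments_of_orient_ne_zero _ hz hz'
      (by rw [orient_position, hr, Int.cast_zero])
      (by rw [orient_position]; exact Int.cast_ne_zero.2 hne)
    rcases h with h | h <;> rw [h] at this
    · exact Or.inl this
    · exact Or.inr this
  · have hr : localOrient e.1 e.2 f.2 = 0 := by
      rcases h with h | h <;> rw [h] <;> assumption
    have := eq_of_mem_segments_of_orient_ne_zero _ hz
      (by rwa [segment_symm] at hz' : z ∈ segment ℝ (position (ofLocal i f.2)) _)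
      (by rw [orient_position, hr, Int.cast_zero])
      (by rw [orient_position]; exact Int.cast_ne_zero.2 hne)
    rcases h with h | h <;> rw [h] at this
    · exact Or.inl this
    · exact Or.inr this

/-- Within one copy this is the finite check, up to reversing either edge. Edges of different copies
lie in disjoint open cones except for the hub. -/
theorem position_crossing {u v u' v' : Vertex ℓ} (huv : (supportGraph ℓ).Adj u v)
    (huv' : (supportGraph ℓ).Adj u' v') (h1 : ¬ (u = u' ∧ v = v')) (h2 : ¬ (u = v' ∧ v = u'))
    {z : Plane} (hz : z ∈ segment ℝ (position u) (position v))
    (hz' : z ∈ segment ℝ (position u') (position v')) : z = position u ∨ z = position v := by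
  obtain ⟨i, x, y, hxy, rfl, rfl⟩ := huv
  obtain ⟨j, x', y', hxy', rfl, rfl⟩ := huv'
  by_cases hij : i = j
  · subst hij
    have g1 : (x, y) ≠ (x', y') := fun h => h1 (by simp_all)
    have g2 : (x, y) ≠ (y', x') := fun h => h2 (by simp_all)
    have g3 : (y, x) ≠ (x', y') := fun h => h2 (by simp_all)
    have g4 : (y, x) ≠ (y', x') := fun h => h1 (by simp_all)
    rcases hxy with hxy | hxy <;> rcases hxy' with hxy' | hxy'
    · exact eq_of_uncrossed (uncrossed_localEdges _ hxy _ hxy' g1) hz hz'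
    · exact eq_of_uncrossed (uncrossed_localEdges _ hxy _ hxy' g2) hz (by rwa [segment_symm])
    · exact (eq_of_uncrossed (uncrossed_localEdges _ hxy _ hxy' g3)
        (by rwa [segment_symm]) hz').symm
    · exact (eq_of_uncrossed (uncrossed_localEdges _ hxy _ hxy' g4)
        (by rwa [segment_symm]) (by rwa [segment_symm])).symm
  · rcases mem_cone_of_mem_segment hxy hz with hc | ⟨rfl, rfl | rfl⟩
    · rcases mem_cone_of_mem_segment hxy' hz' with hc' | ⟨rfl, -⟩
      · exact absurd (Fin.ext (eq_of_mem_cone hc hc')) hij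
      · exact absurd hc (zero_notMem_cone _)
    · exact Or.inl rfl
    · exact Or.inr rfl

theorem exists_localAdj (x : Label) : ∃ y, LocalAdj (some x) y := by
  cases x
  case t => exact ⟨some .a, by decide +kernel⟩
  case t' => exact ⟨some .b, by decide +kernel⟩
  case a => exact ⟨none, by decide +kernel⟩
  case b => exact ⟨none, by decide +kernel⟩
  case c => exact ⟨none, by decide +kernel⟩
  case vd => exact ⟨some .d, by decide +kernel⟩
  case ud => exact ⟨some .d, by decide +kernel⟩
  case d => exact ⟨some .a, by decide +kernel⟩
  case va => exact ⟨some .a, by decide +kernel⟩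
  case vb => exact ⟨some .b, by decide +kernel⟩
  case ub => exact ⟨some .b, by decide +kernel⟩
  case uc => exact ⟨some .c, by decide +kernel⟩

theorem exists_supportGraph_adj (hℓ : 1 ≤ ℓ) (w : Vertex ℓ) : ∃ w', (supportGraph ℓ).Adj w w' := by
  rcases w with _ | ⟨i, x⟩
  · exact ⟨_, ⟨0, hℓ⟩, none, some .a, by decide +kernel, rfl, rfl⟩
  · obtain ⟨y, hy⟩ := exists_localAdj x
    exact ⟨_, i, some x, y, hy, rfl, rfl⟩

theorem isPlanar_comap_supportGraph (hℓ : 1 ≤ ℓ) :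
    IsPlanar ((supportGraph ℓ).comap (Subtype.val : (twinHypergraph ℓ).vertexSet → Vertex ℓ)) := by
  refine isPlanar_of_segments _ (fun v => position v.1)
    (position_injective.comp Subtype.val_injective) (fun w => ?_) ?_
  · obtain ⟨w', hw'⟩ := exists_supportGraph_adj hℓ w.1
    exact ⟨⟨w', Set.mem_univ _⟩, hw'⟩
  · intro u v u' v' huv huv' h1 h2 z hz hz'
    exact position_crossing huv huv' (fun h => h1 ⟨Subtype.ext h.1, Subtype.ext h.2⟩)
      (fun h => h2 ⟨Subtype.ext h.1, Subtype.ext h.2⟩) hz hz'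

theorem connected_induce_of_isLinked {α : Type*} {s F : Set α} {G : SimpleGraph α} (hF : F ⊆ s)
    (hne : F.Nonempty) (h : IsLinked G.Adj F) :
    ((G.comap (Subtype.val : s → α)).induce {v : s | (v : α) ∈ F}).Connected := by
  obtain ⟨x₀, hx₀⟩ := hne
  rw [SimpleGraph.connected_iff]
  refine ⟨?_, ⟨⟨⟨x₀, hF hx₀⟩, hx₀⟩⟩⟩
  rintro ⟨⟨x, hxs⟩, hx⟩ ⟨⟨y, hys⟩, hy⟩
  have key : ∀ y, Relation.ReflTransGen (fun u v => G.Adj u v ∧ u ∈ F ∧ v ∈ F) x y →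
      ∃ hy : y ∈ F, ((G.comap (Subtype.val : s → α)).induce {v : s | (v : α) ∈ F}).Reachable
        ⟨⟨x, hxs⟩, hx⟩ ⟨⟨y, hF hy⟩, hy⟩ := by
    intro y hxy
    induction hxy with
    | refl => exact ⟨hx, .refl _⟩
    | tail _ hE ih =>
      obtain ⟨_, ih⟩ := ih
      exact ⟨hE.2.2, ih.trans (SimpleGraph.Adj.reachable hE.1)⟩
  exact (key y (h x hx y hy)).2

theorem isLinked_largeEdge {x y z : Label} (h : (x, y, z) ∈ largeTriples) :
    IsLinked (supportGraph ℓ).Adj (largeEdge ℓ x y z) := by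
  -- Every large triple contains two of a, b, c. Since t sees a and b, and t' sees b and c, both
  -- twins of a copy reach the hub through x or y, and z hangs on one of the twins.
  have hloc : LocalAdj (some x) none ∧ LocalAdj (some y) none ∧
      (LocalAdj (some .t) (some x) ∨ LocalAdj (some .t) (some y)) ∧
      (LocalAdj (some .t') (some x) ∨ LocalAdj (some .t') (some y)) ∧
      (LocalAdj (some z) (some .t) ∨ LocalAdj (some z) (some .t')) := by
    simp only [largeTriples, Set.mem_insert_iff, Set.mem_singleton_iff, Prod.mk.injEq] at h
    rcases h with ⟨rfl, rfl, rfl⟩ | ⟨rfl, rfl, rfl⟩ | ⟨rfl, rfl, rfl⟩ | ⟨rfl, rfl, rfl⟩ |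
      ⟨rfl, rfl, rfl⟩ | ⟨rfl, rfl, rfl⟩ | ⟨rfl, rfl, rfl⟩ | ⟨rfl, rfl, rfl⟩ <;> decide +kernel
  obtain ⟨hx, hy, ht, ht', hz⟩ := hloc
  set W := largeEdge ℓ x y z
  have mx : ∀ i, .copy i x ∈ W := fun i => mem_largeEdge.2 (Or.inl ⟨i, rfl⟩)
  have my : ∀ i, .copy i y ∈ W := fun i => mem_largeEdge.2 (Or.inr (Or.inl ⟨i, rfl⟩))
  have mz : ∀ i, .copy i z ∈ W := fun i => mem_largeEdge.2 (Or.inr (Or.inr (Or.inl ⟨i, rfl⟩)))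
  have mt : ∀ i, .copy i .t ∈ W := fun i =>
    mem_largeEdge.2 (Or.inr (Or.inr (Or.inr (Or.inl (copy_mem_twinSet.2 (Or.inl rfl))))))
  have mt' : ∀ i, .copy i .t' ∈ W := fun i =>
    mem_largeEdge.2 (Or.inr (Or.inr (Or.inr (Or.inl (copy_mem_twinSet.2 (Or.inr rfl))))))
  have mh : .hub ∈ W := mem_largeEdge.2 (by simp)
  have step : ∀ (i : Fin ℓ) {p q : LocalVertex}, LocalAdj p q → ofLocal i p ∈ W →
      ofLocal i q ∈ W → Relation.ReflTransGen
        (fun u v => (supportGraph ℓ).Adj u v ∧ u ∈ W ∧ v ∈ W) (ofLocal i p) (ofLocal i q) :=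
    fun i p q hpq hp hq => .single ⟨⟨i, p, q, hpq, rfl, rfl⟩, hp, hq⟩
  have cx := fun i => step i hx (mx i) mh
  have cy := fun i => step i hy (my i) mh
  have ct := fun i => ht.elim (fun h => (step i h (mt i) (mx i)).trans (cx i))
    fun h => (step i h (mt i) (my i)).trans (cy i)
  have ct' := fun i => ht'.elim (fun h => (step i h (mt' i) (mx i)).trans (cx i))
    fun h => (step i h (mt' i) (my i)).trans (cy i)
  refine isLinked_of_root (fun _ _ e => e.symm) .hub fun w hw => ?_
  rcases mem_largeEdge.1 hw with ⟨i, rfl⟩ | ⟨i, rfl⟩ | ⟨i, rfl⟩ | hw | rfl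
  · exact cx i
  · exact cy i
  · exact hz.elim (fun h => (step i h (mz i) (mt i)).trans (ct i))
      fun h => (step i h (mz i) (mt' i)).trans (ct' i)
  · obtain ⟨i, rfl | rfl⟩ := mem_twinSet.1 hw
    · exact ct i
    · exact ct' i
  · exact .refl

theorem localAdj_of_mem_solidPairs {x y : Label} (h : (x, y) ∈ solidPairs) :
    LocalAdj (some x) (some y) := by
  simp only [solidPairs, Set.mem_insert_iff, Set.mem_singleton_iff, Prod.mk.injEq] at h
  rcases h with ⟨rfl, rfl⟩ | ⟨rfl, rfl⟩ | ⟨rfl, rfl⟩ | ⟨rfl, rfl⟩ | ⟨rfl, rfl⟩ | ⟨rfl, rfl⟩ |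
    ⟨rfl, rfl⟩ | ⟨rfl, rfl⟩ | ⟨rfl, rfl⟩ | ⟨rfl, rfl⟩ | ⟨rfl, rfl⟩ | ⟨rfl, rfl⟩ |
    ⟨rfl, rfl⟩ | ⟨rfl, rfl⟩ | ⟨rfl, rfl⟩ | ⟨rfl, rfl⟩ <;> decide +kernel

theorem hasPlanarSupport_twinHypergraph (hℓ : 1 ≤ ℓ) : HasPlanarSupport (twinHypergraph ℓ) := by
  refine ⟨_, fun F hF => ?_, isPlanar_comap_supportGraph hℓ⟩
  have pair : ∀ {u v}, (supportGraph ℓ).Adj u v → IsLinked (supportGraph ℓ).Adj {u, v} :=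
    fun h => (isLinked_singleton _ _).union (fun _ _ e => e.symm) (isLinked_singleton _ _)
      ⟨_, rfl, _, rfl, h⟩
  refine connected_induce_of_isLinked (Set.subset_univ _) ?_ ?_
  · rcases hF with (⟨i, x, y, -, rfl⟩ | ⟨i, x, -, rfl⟩) | ⟨x, y, z, -, rfl⟩
    · exact ⟨_, Or.inl rfl⟩
    · exact ⟨_, Or.inl rfl⟩
    · exact ⟨.hub, Or.inr rfl⟩
  · rcases hF with (⟨i, x, y, h, rfl⟩ | ⟨i, x, h, rfl⟩) | ⟨x, y, z, h, rfl⟩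
    · exact pair ⟨i, _, _, localAdj_of_mem_solidPairs h, rfl, rfl⟩
    · refine pair ⟨i, some x, none, ?_, rfl, rfl⟩
      rcases h with rfl | rfl | rfl <;> decide +kernel
    · exact isLinked_largeEdge h

/-! ### The twin class -/

theorem ne_of_mem_solidPairs {x y : Label} (h : (x, y) ∈ solidPairs) : x ≠ y := by
  rintro rfl
  rcases localAdj_of_mem_solidPairs h with h | h <;> exact ne_of_mem_localEdges _ h rfl

theorem two_le_ncard_of_mem_edgeSet (hℓ : 1 ≤ ℓ) {F : Set (Vertex ℓ)}
    (hF : F ∈ (twinHypergraph ℓ).edgeSet) : 2 ≤ F.ncard := by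
  change 1 < F.ncard
  rw [Set.one_lt_ncard_iff]
  rcases hF with (⟨i, x, y, h, rfl⟩ | ⟨i, x, -, rfl⟩) | ⟨x, y, z, -, rfl⟩
  · exact ⟨.copy i x, .copy i y, Or.inl rfl, Or.inr rfl, by simpa using ne_of_mem_solidPairs h⟩
  · exact ⟨.copy i x, .hub, Or.inl rfl, Or.inr rfl, by simp⟩
  · exact ⟨.copy ⟨0, hℓ⟩ x, .hub, mem_largeEdge.2 (Or.inl ⟨_, rfl⟩), Or.inr rfl, by simp⟩

theorem notMem_twinSet_of_mem_solidPairs {x y : Label} (h : (x, y) ∈ solidPairs) (i j : Fin ℓ) :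
    Vertex.copy i x ∉ twinSet ℓ ∧ Vertex.copy j y ∉ twinSet ℓ := by
  rw [copy_mem_twinSet, copy_mem_twinSet]
  simp only [solidPairs, Set.mem_insert_iff, Set.mem_singleton_iff, Prod.mk.injEq] at h
  rcases h with ⟨rfl, rfl⟩ | ⟨rfl, rfl⟩ | ⟨rfl, rfl⟩ | ⟨rfl, rfl⟩ | ⟨rfl, rfl⟩ | ⟨rfl, rfl⟩ |
    ⟨rfl, rfl⟩ | ⟨rfl, rfl⟩ | ⟨rfl, rfl⟩ | ⟨rfl, rfl⟩ | ⟨rfl, rfl⟩ | ⟨rfl, rfl⟩ |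
    ⟨rfl, rfl⟩ | ⟨rfl, rfl⟩ | ⟨rfl, rfl⟩ | ⟨rfl, rfl⟩ <;> simp

/-- The right side does not mention `t`, so all members of T are twins. -/
theorem incidentEdges_of_mem_twinSet {t : Vertex ℓ} (ht : t ∈ twinSet ℓ) :
    incidentEdges (twinHypergraph ℓ) t =
      {F | ∃ x y z : Label, (x, y, z) ∈ largeTriples ∧ F = largeEdge ℓ x y z} := by
  ext F
  constructor
  · rintro ⟨(⟨i, x, y, h, rfl⟩ | ⟨i, x, h, rfl⟩) | hF, htF⟩
    · obtain ⟨h1, h2⟩ := notMem_twinSet_of_mem_solidPairs h i i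
      rcases htF with rfl | rfl
      · exact absurd ht h1
      · exact absurd ht h2
    · rcases htF with rfl | rfl
      · rw [copy_mem_twinSet] at ht
        rcases h with rfl | rfl | rfl <;> simp at ht
      · exact absurd ht (hub_notMem_twinSet ℓ)
    · exact hF
  · rintro ⟨x, y, z, h, rfl⟩
    exact ⟨Or.inr ⟨x, y, z, h, rfl⟩,
      mem_largeEdge.2 (Or.inr (Or.inr (Or.inr (Or.inl ht))))⟩

theorem exists_solidPairs_of_notMem_twinSet {x : Label} (h : x ≠ .t) (h' : x ≠ .t') :
    ∃ y, (x, y) ∈ solidPairs ∨ (y, x) ∈ solidPairs := by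
  cases x
  case t => exact absurd rfl h
  case t' => exact absurd rfl h'
  case a => exact ⟨.b, by simp [solidPairs]⟩
  case b => exact ⟨.a, by simp [solidPairs]⟩
  case c => exact ⟨.a, by simp [solidPairs]⟩
  case d => exact ⟨.a, by simp [solidPairs]⟩
  case va => exact ⟨.a, by simp [solidPairs]⟩
  case vb => exact ⟨.b, by simp [solidPairs]⟩
  case vd => exact ⟨.d, by simp [solidPairs]⟩
  case ub => exact ⟨.b, by simp [solidPairs]⟩
  case uc => exact ⟨.c, by simp [solidPairs]⟩
  case ud => exact ⟨.d, by simp [solidPairs]⟩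

/-- A vertex outside `T` lies in a hyperedge that contains no vertex of `T`. -/
theorem exists_edge_of_notMem_twinSet (hℓ : 1 ≤ ℓ) {w : Vertex ℓ} (hw : w ∉ twinSet ℓ) :
    ∃ F ∈ (twinHypergraph ℓ).edgeSet, w ∈ F ∧ Disjoint F (twinSet ℓ) := by
  rcases w with _ | ⟨i, x⟩
  · refine ⟨_, Or.inl (Or.inr ⟨⟨0, hℓ⟩, .a, Or.inl rfl, rfl⟩), Or.inr rfl, ?_⟩
    rw [Set.disjoint_left]
    rintro _ (rfl | rfl)
    · simp [copy_mem_twinSet]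
    · exact hw
  · rw [copy_mem_twinSet, not_or] at hw
    obtain ⟨y, h | h⟩ := exists_solidPairs_of_notMem_twinSet hw.1 hw.2 <;>
      obtain ⟨h1, h2⟩ := notMem_twinSet_of_mem_solidPairs h i i
    · refine ⟨_, Or.inl (Or.inl ⟨i, x, y, h, rfl⟩), Or.inl rfl, ?_⟩
      rw [Set.disjoint_left]
      rintro _ (rfl | rfl) <;> assumption
    · refine ⟨_, Or.inl (Or.inl ⟨i, y, x, h, rfl⟩), Or.inr rfl, ?_⟩
      rw [Set.disjoint_left]
      rintro _ (rfl | rfl) <;> assumption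

theorem isTwinClass_twinSet (hℓ : 1 ≤ ℓ) : IsTwinClass (twinHypergraph ℓ) (twinSet ℓ) := by
  have hu : Vertex.copy ⟨0, hℓ⟩ .t ∈ twinSet ℓ := copy_mem_twinSet.2 (Or.inl rfl)
  refine ⟨_, Set.mem_univ (Vertex.copy ⟨0, hℓ⟩ .t), ?_⟩
  ext w
  constructor
  · intro hw
    exact ⟨Set.mem_univ _,
      (incidentEdges_of_mem_twinSet hw).trans (incidentEdges_of_mem_twinSet hu).symm⟩
  · rintro ⟨-, hw⟩
    by_contra hn
    obtain ⟨F, hF, hwF, hd⟩ := exists_edge_of_notMem_twinSet hℓ hn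
    have : F ∈ incidentEdges (twinHypergraph ℓ) w := ⟨hF, hwF⟩
    rw [hw] at this
    exact Set.disjoint_left.1 hd this.2 hu

end HypergraphTwins

theorem mainTheorem7 (ℓ : ℕ) (hℓ : 1 ≤ ℓ) :
    -- a finite hypergraph without hyperedges of size at most one
    (HypergraphTwins.twinHypergraph ℓ).vertexSet.Finite ∧
    (∀ F ∈ (HypergraphTwins.twinHypergraph ℓ).edgeSet, 2 ≤ F.ncard) ∧
    -- `T` is a twin class with `2ℓ` vertices
    HypergraphTwins.IsTwinClass (HypergraphTwins.twinHypergraph ℓ) (HypergraphTwins.twinSet ℓ) ∧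
    (HypergraphTwins.twinSet ℓ).ncard = 2 * ℓ ∧
    HypergraphTwins.HasPlanarSupport (HypergraphTwins.twinHypergraph ℓ) ∧
    -- removing any vertex of `T` destroys all planar supports
    (∀ t ∈ HypergraphTwins.twinSet ℓ, ¬ HypergraphTwins.HasPlanarSupport
      (HypergraphTwins.removeVertices (HypergraphTwins.twinHypergraph ℓ) {t})) ∧
    -- and so does removing any nonempty set of vertices of `T`
    (∀ S ⊆ HypergraphTwins.twinSet ℓ, S.Nonempty → ¬ HypergraphTwins.HasPlanarSupport
      (HypergraphTwins.removeVertices (HypergraphTwins.twinHypergraph ℓ) S)) := by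
  refine ⟨Set.toFinite _, fun F hF => HypergraphTwins.two_le_ncard_of_mem_edgeSet hℓ hF,
    HypergraphTwins.isTwinClass_twinSet hℓ, HypergraphTwins.ncard_twinSet ℓ,
    HypergraphTwins.hasPlanarSupport_twinHypergraph hℓ, fun t ht => ?_, fun S hS hne =>
    HypergraphTwins.not_hasPlanarSupport_removeVertices hℓ hS hne⟩
  exact HypergraphTwins.not_hasPlanarSupport_removeVertices hℓ (Set.singleton_subset_iff.2 ht)
    (Set.singleton_nonempty t)
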